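/- **Setting.** Let $d=d_1+d_2$ with $d_1,d_2\in\mathbb N_0$, write $\mathbb R^d=\mathbb R^{d_1}\times\mathbb R^{d_2}$, and let $E(n)$ denote the group of Euclidean isometries $g\cdot x=\mathrm{rot}(g)x+\mathrm{trans}(g)$ of $\mathbb R^n$. A subgroup is discrete if all its orbits are discrete. A space group in $E(d_2)$ is a discrete subgroup containing $d_2$ translations with linearly independent translation vectors. For $A\in O(d_1)$, $h\in E(d_2)$ put $(A\oplus h)\cdot(x_1,x_2)=(Ax_1,h\cdot x_2)$ and $\pi(A\oplus h)=h$. Let $\mathcal S$ be a space group in $E(d_2)$, and let $\mathcal G<O(d_1)\oplus\mathcal S$ be a discrete subgroup of $E(d)$ with $\pi(\mathcal G)=\mathcal S$. Let $x_0\in\mathbb R^d$ be such that $g\mapsto g\cdot x_0$ is injective on $\mathcal G$. **Periodic functions.** Let $\mathcal T\subset\mathcal G$ be a set that $\pi$ maps bijectively onto the translation subgroup of $\mathcal S$. For $N\ge1$ let $\mathcal T^N=\{t^N: t\in\mathcal T\}$, and let $M_0$ be the set of those $N\geq 1$ for which $\mathcal T^N$ is a normal subgroup of $\mathcal G$. A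 function $u$ on $\mathcal G$ is $\mathcal T^N$-periodic if $u(gt)=u(g)$ for all $g\in\mathcal G$, $t\in\mathcal T^N$, and periodic if it is $\mathcal T^N$-periodic for some $N\in M_0$. Let $U_{\mathrm{per}}$ be the space of periodic $u:\mathcal G\to\mathbb R^d$ with the uniform norm $\|\cdot\|_\infty$, and let $\mathcal C_N$ be a (finite) set of representatives of $\mathcal G/\mathcal T^N$. **Energy.** Let $V:(\mathbb R^d)^{\mathcal G\setminus\{\mathrm{id}\}}\to\mathbb R$ satisfy $V(Qy)=V(y)$ for all $Q\in O(d)$ and all $y$, and suppose that for every $y$ the map $z\mapsto V(y+z)$ is twice continuously Fréchet differentiable on $L^\infty(\mathcal G\setminus\{\mathrm{id}\},\mathbb R^d)$. $V$ has finite interaction range if there is a finite $\mathcal R_V\subset\mathcal G\setminus\{\mathrm{id}\}$ with $V(y)=V(\chi_{\mathcal R_V}y)$ for all $y$. Put $y_0=(g\cdot x_0-x_0)_{g\ne \mathrm{id}}$, $(\partial_gV(y))_i=V'(y)(\delta_ge_i)$ and $$e_V=\sum_{g\in\mathcal G\setminus\{\mathrm{id}\}}\partial_gV(y_0)(\mathrm{rot}(g)-I_d).$$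 For a $\mathcal T^N$-periodic $w$, $N\in M_0$, let $$E(w)=\frac1{|\mathcal C_N|}\sum_{g\in\mathcal C_N}V\Big(\big((gh)\cdot w(gh)-g\cdot w(g)\big)_{h\in\mathcal G\setminus\{\mathrm{id}\}}\Big).$$ Write $x_0$ also for the constant function with value $x_0$ (the identity configuration). **Stability constant.** Let $\mathcal R\subset\mathcal G$ be finite such that there are $\mathcal R',\mathcal R''\subset\mathcal G$ with $\mathrm{id}\in\mathcal R'$, $\mathcal R'$ generating $\mathcal G$, $\mathrm{id}\in\mathcal R''$, $\mathcal R''$ finite, $\mathrm{aff}(\mathcal R''\cdot x_0)=\mathrm{aff}(\mathcal G\cdot x_0)$ and $\mathcal R'\mathcal R''\subset\mathcal R$. Let $U_{\mathrm{iso},0,0}(\mathcal R)$ be the space of all $v:\mathcal R\to\mathbb R^d$ for which there are $a\in\mathbb R^d$ and a skew symmetric $S_1\in\mathbb R^{d_1\times d_1}$ with $\mathrm{rot}(g)v(g)=a+(S_1\oplus0_{d_2,d_2})(g\cdot x_0-x_0)$ for all $g\in\mathcal R$, and let $P$ be the orthogonal projection of $(\mathbb R^d)^{\mathcal R}$ (with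 the Euclidean norm) with kernel $U_{\mathrm{iso},0,0}(\mathcal R)$. For a $\mathcal T^N$-periodic $u\in U_{\mathrm{per}}$, $N\in M_0$, let $$\|u\|_{\mathcal R,0,0}=\Big(\frac1{|\mathcal C_N|}\sum_{g\in\mathcal C_N}\|P(u(g\,\cdot)|_{\mathcal R})\|^2\Big)^{1/2},$$ and, with $E''(x_0)$ the second Fréchet derivative of $E$ on $(U_{\mathrm{per}},\|\cdot\|_\infty)$ at $x_0$, $$\lambda_{a,0,0}=\sup\{c\in\mathbb R:\ c\,\|u\|_{\mathcal R,0,0}^2\le E''(x_0)(u,u)\ \text{ for all }u\in U_{\mathrm{per}}\}\in[-\infty,\infty].$$ **Theorem.** Suppose that $d_1\in\{0,1,d\}$, $V$ has finite interaction range, $e_V=0$ and $\lambda_{a,0,0}>0$. Then $E$ has a local minimum point at $x_0$ with respect to $\|\cdot\|_\infty$, i.e. there is a neighborhood $U\subset U_{\mathrm{per}}$ of $0$ with respect to $\|\cdot\|_\infty$ such that $E(x_0+u)\ge E(x_0)$ for all $u\in U$. -/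

import Mathlib

open scoped ENNReal Topology Pointwise

noncomputable section

namespace ObjStruct

/-! ### The Euclidean group and its discrete subgroups -/

/-- `ℝ^ι` with the Euclidean norm. For `ι = Fin d₁ ⊕ Fin d₂` this is `ℝ^d = ℝ^{d₁} × ℝ^{d₂}`,
`d = d₁ + d₂`. -/
abbrev Vec (ι : Type) [Fintype ι] : Type := EuclideanSpace ℝ ι

/-- The Euclidean group `E(d)`, with composition as group operation. -/
abbrev Euc (ι : Type) [Fintype ι] : Type := Vec ι ≃ᵃⁱ[ℝ] Vec ι

/-- The orthogonal group `O(d)`. -/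
abbrev Orth (ι : Type) [Fintype ι] : Type := Vec ι ≃ₗᵢ[ℝ] Vec ι

/-- The linear component of a Euclidean isometry. -/
def rot {ι : Type} [Fintype ι] (g : Euc ι) : Orth ι := g.linearIsometryEquiv

/-- The translation component of a Euclidean isometry. -/
def trans {ι : Type} [Fintype ι] (g : Euc ι) : Vec ι := g 0

/-- `g` is a translation. -/
def IsTranslation {ι : Type} [Fintype ι] (g : Euc ι) : Prop := rot g = 1

/-- A subgroup of `E(d)` is discrete if all of its orbits in `ℝ^d` are discrete. -/
def IsDiscreteGroup {ι : Type} [Fintype ι] (G : Subgroup (Euc ι)) : Prop :=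
  ∀ x : Vec ι, IsDiscrete (Set.range fun g : G => (g : Euc ι) x)

/-- A space group: a discrete subgroup of `E(n)` which contains `n` translations whose
translation components are linearly independent. -/
def IsSpaceGroup {n : ℕ} (S : Subgroup (Euc (Fin n))) : Prop :=
  IsDiscreteGroup S ∧ ∃ t : Fin n → Euc (Fin n),
    (∀ i, t i ∈ S ∧ IsTranslation (t i)) ∧ LinearIndependent ℝ fun i => trans (t i)

variable {d₁ d₂ : ℕ}

/-- The `ℝ^{d₁}`-component of a vector. -/
def fstPart (x : Vec (Fin d₁ ⊕ Fin d₂)) : Vec (Fin d₁) := WithLp.toLp 2 fun i => x (Sum.inl i)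

/-- The `ℝ^{d₂}`-component of a vector. -/
def sndPart (x : Vec (Fin d₁ ⊕ Fin d₂)) : Vec (Fin d₂) := WithLp.toLp 2 fun i => x (Sum.inr i)

/-- `g = A ⊕ h`, i.e. `g · (x₁, x₂) = (A x₁, h · x₂)`, where `A ∈ O(d₁)` and `h ∈ E(d₂)`. -/
def IsDirectSum (g : Euc (Fin d₁ ⊕ Fin d₂)) (A : Orth (Fin d₁)) (h : Euc (Fin d₂)) : Prop :=
  ∀ x, fstPart (g x) = A (fstPart x) ∧ sndPart (g x) = h (sndPart x)

/-- `π(g) = h`, where `π : O(d₁) ⊕ E(d₂) → E(d₂)`, `A ⊕ h ↦ h`. -/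
def ProjectsTo (g : Euc (Fin d₁ ⊕ Fin d₂)) (h : Euc (Fin d₂)) : Prop :=
  ∃ A : Orth (Fin d₁), IsDirectSum g A h

/-- `G` is a subgroup of `O(d₁) ⊕ S` with `π(G) = S`. -/
def IsSubgroupOver (G : Subgroup (Euc (Fin d₁ ⊕ Fin d₂))) (S : Subgroup (Euc (Fin d₂))) : Prop :=
  (∀ g ∈ G, ∃ h ∈ S, ProjectsTo g h) ∧ ∀ h ∈ S, ∃ g ∈ G, ProjectsTo g h

/-- `T ⊆ G` is a section of the translation subgroup `T_S` of `S`: `π` maps `T` bijectively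
onto `T_S`. -/
def IsTranslationSection (G : Subgroup (Euc (Fin d₁ ⊕ Fin d₂))) (S : Subgroup (Euc (Fin d₂)))
    (T : Set G) : Prop :=
  (∀ t ∈ T, ∃ s ∈ S, IsTranslation s ∧ ProjectsTo (t : Euc (Fin d₁ ⊕ Fin d₂)) s) ∧
  ∀ s ∈ S, IsTranslation s → ∃! t : G, t ∈ T ∧ ProjectsTo (t : Euc (Fin d₁ ⊕ Fin d₂)) s

/-! ### Periodic functions -/

section Periodic

variable {Γ : Type} [Group Γ]

/-- The subgroup generated by `T^N = {t^N | t ∈ T}`; it is only used when `T^N` itself is a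
subgroup, see `Admissible`. -/
def powGroup (T : Set Γ) (N : ℕ) : Subgroup Γ := Subgroup.closure ((fun t => t ^ N) '' T)

/-- `N` is a positive integer for which `T^N` is a normal subgroup. -/
def Admissible (T : Set Γ) (N : ℕ) : Prop :=
  0 < N ∧ (powGroup T N : Set Γ) = (fun t => t ^ N) '' T ∧ (powGroup T N).Normal

/-- `u(g) = u(g t)` for all `g` and all `t ∈ T^N`. -/
def PeriodicWith {X : Type} (T : Set Γ) (N : ℕ) (u : Γ → X) : Prop :=
  ∀ g : Γ, ∀ t ∈ powGroup T N, u g = u (g * t)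

/-- A period of `u` (the least one): an admissible `N` such that `u` is `T^N`-periodic. -/
def period {X : Type} (T : Set Γ) (u : Γ → X) : ℕ :=
  sInf {N | Admissible T N ∧ PeriodicWith T N u}

/-- The mean `|C|⁻¹ ∑_{g ∈ C} f(g)` over a set `C` of representatives of `Γ ⧸ H`. -/
def cellMean (H : Subgroup Γ) (f : Γ → ℝ) : ℝ :=
  (Nat.card (Γ ⧸ H) : ℝ)⁻¹ * ∑ᶠ q : Γ ⧸ H, f q.out

/-- The bounded functions on `ι`, with the uniform norm. -/
abbrev Bdd (ι : Type) (E : Type) [NormedAddCommGroup E] : Type := lp (fun _ : ι => E) ∞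

/-- The `T^N`-periodic bounded functions. -/
def UperN (T : Set Γ) (E : Type) [NormedAddCommGroup E] [NormedSpace ℝ E] (N : ℕ) :
    Submodule ℝ (Bdd Γ E) where
  carrier := {u | PeriodicWith T N fun g => u g}
  add_mem' := by
    intro u v hu hv g t ht
    have h1 := hu g t ht
    have h2 := hv g t ht
    simp only [lp.coeFn_add, Pi.add_apply] at *
    rw [h1, h2]
  zero_mem' := by
    intro g t _
    simp
  smul_mem' := by
    intro c u hu g t ht
    have h1 := hu g t ht
    simp only [lp.coeFn_smul, Pi.smul_apply] at *
    rw [h1]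

/-- The space `U_per` of periodic functions with the uniform norm: the union of the directed
family of spaces of `T^N`-periodic functions, `N` admissible. (`T^N` has finite index for the
groups considered here, hence periodic functions are bounded.) -/
def Uper (T : Set Γ) (E : Type) [NormedAddCommGroup E] [NormedSpace ℝ E] :
    Submodule ℝ (Bdd Γ E) :=
  ⨆ N : {N : ℕ // Admissible T N}, UperN T E N

end Periodic

/-! ### Interaction potentials -/

section Energy

variable {G : Subgroup (Euc (Fin d₁ ⊕ Fin d₂))}

/-- `ℝ^d`-valued functions on `G ∖ {id}`. -/
abbrev Config (G : Subgroup (Euc (Fin d₁ ⊕ Fin d₂))) : Type :=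
  {g : G // g ≠ 1} → Vec (Fin d₁ ⊕ Fin d₂)

/-- Invariance of `V` under `O(d)`. -/
def OrthInvariant (V : Config G → ℝ) : Prop :=
  ∀ (Q : Orth (Fin d₁ ⊕ Fin d₂)) (y : Config G), V (fun g => Q (y g)) = V y

/-- For every `y` the map `z ↦ V(y + z)` is twice continuously Fréchet differentiable on the
space of bounded `z`, with the uniform norm. -/
def SmoothPotential (V : Config G → ℝ) : Prop :=
  ∀ y : Config G, ContDiff ℝ 2
    fun z : Bdd {g : G // g ≠ 1} (Vec (Fin d₁ ⊕ Fin d₂)) => V fun g => y g + z g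

/-- `RV` is an interaction range of `V`. -/
def IsInteractionRange (V : Config G → ℝ) (RV : Set {g : G // g ≠ 1}) : Prop :=
  ∀ y : Config G, V y = V (RV.indicator y)

/-- `V` has finite interaction range. -/
def HasFiniteRange (V : Config G → ℝ) : Prop :=
  ∃ RV : Set {g : G // g ≠ 1}, RV.Finite ∧ IsInteractionRange V RV

/-- The reference configuration `y₀ = (g · x₀ - x₀)_{g ≠ id}`. -/
def refConfig (G : Subgroup (Euc (Fin d₁ ⊕ Fin d₂))) (x₀ : Vec (Fin d₁ ⊕ Fin d₂)) : Config G :=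
  fun g => (g.1 : Euc (Fin d₁ ⊕ Fin d₂)) x₀ - x₀

open Classical in
/-- The partial Jacobian `(∂_g V(y))_i = V'(y)(δ_g e_i)`. -/
def partialV (V : Config G → ℝ) (y : Config G) (g : {g : G // g ≠ 1}) (i : Fin d₁ ⊕ Fin d₂) : ℝ :=
  fderiv ℝ (fun z : Bdd {g : G // g ≠ 1} (Vec (Fin d₁ ⊕ Fin d₂)) => V fun g => y g + z g) 0
    (lp.single ∞ g (EuclideanSpace.single i (1 : ℝ)))

/-- The matrix of the linear component of a Euclidean isometry. -/
def rotMatrix {ι : Type} [Fintype ι] [DecidableEq ι] (g : Euc ι) : Matrix ι ι ℝ :=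
  Matrix.of fun i j => rot g (EuclideanSpace.single j (1 : ℝ)) i

/-- The row vector `e_V = ∑_{g ≠ id} ∂_g V(y₀) (rot(g) - I_d)`. -/
def eVec (V : Config G → ℝ) (x₀ : Vec (Fin d₁ ⊕ Fin d₂)) : Fin d₁ ⊕ Fin d₂ → ℝ :=
  ∑' g : {g : G // g ≠ 1}, Matrix.vecMul (partialV V (refConfig G x₀) g)
    (rotMatrix (g.1 : Euc (Fin d₁ ⊕ Fin d₂)) - 1)

/-- The configurational energy
`E(w) = |C_N|⁻¹ ∑_{g ∈ C_N} V(((g h) · w(g h) - g · w(g))_{h ≠ id})`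
of a periodic `w : G → ℝ^d`; it depends neither on the period nor on the representatives. -/
def energy (T : Set G) (V : Config G → ℝ) (w : G → Vec (Fin d₁ ⊕ Fin d₂)) : ℝ :=
  cellMean (powGroup T (period T w)) fun g : G =>
    V fun h => ((g * h.1 : G) : Euc (Fin d₁ ⊕ Fin d₂)) (w (g * h.1)) -
      (g : Euc (Fin d₁ ⊕ Fin d₂)) (w g)

/-- The energy `E(x₀ + u)` as a function of the displacement `u ∈ U_per`, where `x₀` stands for
the constant function (the identity configuration). -/
def displacedEnergy (T : Set G) (V : Config G → ℝ) (x₀ : Vec (Fin d₁ ⊕ Fin d₂))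
    (u : Uper T (Vec (Fin d₁ ⊕ Fin d₂))) : ℝ :=
  energy T V fun g => x₀ + u.1 g

/-- The quadratic form `u ↦ E''(x₀)(u, u)` of the second Fréchet derivative of `E` at the
identity configuration, with respect to the uniform norm on `U_per`. -/
def energyHessian (T : Set G) (V : Config G → ℝ) (x₀ : Vec (Fin d₁ ⊕ Fin d₂))
    (u : Uper T (Vec (Fin d₁ ⊕ Fin d₂))) : ℝ :=
  fderiv ℝ (fderiv ℝ (displacedEnergy T V x₀)) 0 u u

end Energy

/-! ### The seminorm `‖·‖_{R,0,0}` and the stability constant -/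

/-- `Skew_{0,0}(d)`: the skew symmetric matrices `S₁ ⊕ 0` with `S₁ ∈ Skew(d₁)`. -/
def skewZZ (d₁ d₂ : ℕ) : Submodule ℝ (Matrix (Fin d₁ ⊕ Fin d₂) (Fin d₁ ⊕ Fin d₂) ℝ) where
  carrier := {S | S.transpose = -S ∧ S.toBlocks₁₂ = 0 ∧ S.toBlocks₂₂ = 0}
  add_mem' := by
    rintro A B ⟨h1, h2, h3⟩ ⟨k1, k2, k3⟩
    refine ⟨by rw [Matrix.transpose_add, h1, k1, neg_add], ?_, ?_⟩
    · ext i j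
      have a := congrFun (congrFun h2 i) j
      have b := congrFun (congrFun k2 i) j
      simp [Matrix.toBlocks₁₂] at a b ⊢
      rw [a, b, add_zero]
    · ext i j
      have a := congrFun (congrFun h3 i) j
      have b := congrFun (congrFun k3 i) j
      simp [Matrix.toBlocks₂₂] at a b ⊢
      rw [a, b, add_zero]
  zero_mem' := by
    refine ⟨by simp, ?_, ?_⟩ <;> ext i j <;> simp [Matrix.toBlocks₁₂, Matrix.toBlocks₂₂]
  smul_mem' := by
    rintro c A ⟨h1, h2, h3⟩
    refine ⟨by rw [Matrix.transpose_smul, h1, smul_neg], ?_, ?_⟩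
    · ext i j
      have a := congrFun (congrFun h2 i) j
      simp [Matrix.toBlocks₁₂] at a ⊢
      exact Or.inr a
    · ext i j
      have a := congrFun (congrFun h3 i) j
      simp [Matrix.toBlocks₂₂] at a ⊢
      exact Or.inr a

section Seminorm

variable {G : Subgroup (Euc (Fin d₁ ⊕ Fin d₂))}

/-- The space of functions `R → ℝ^d` with the Euclidean norm. -/
abbrev LocalDisp (R : Finset G) : Type := PiLp 2 fun _ : R => Vec (Fin d₁ ⊕ Fin d₂)

/-- `U_trans(R) = {u | ∃ a, ∀ g ∈ R, rot(g) u(g) = a}`. -/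
def Utrans (R : Finset G) : Submodule ℝ (LocalDisp R) where
  carrier := {u | ∃ a : Vec (Fin d₁ ⊕ Fin d₂), ∀ g : R,
    rot (g.1 : Euc (Fin d₁ ⊕ Fin d₂)) (u g) = a}
  add_mem' := by
    rintro u v ⟨a, ha⟩ ⟨b, hb⟩
    exact ⟨a + b, fun g => by rw [PiLp.add_apply, map_add, ha, hb]⟩
  zero_mem' := ⟨0, fun g => by rw [PiLp.zero_apply, map_zero]⟩
  smul_mem' := by
    rintro c u ⟨a, ha⟩
    exact ⟨c • a, fun g => by rw [PiLp.smul_apply, map_smul, ha]⟩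

/-- `U_{rot,0,0}(R) = {u | ∃ S ∈ Skew_{0,0}(d), ∀ g ∈ R, rot(g) u(g) = S (g · x₀ - x₀)}`. -/
def UrotZZ (x₀ : Vec (Fin d₁ ⊕ Fin d₂)) (R : Finset G) : Submodule ℝ (LocalDisp R) where
  carrier := {u | ∃ S ∈ skewZZ d₁ d₂, ∀ g : R, rot (g.1 : Euc (Fin d₁ ⊕ Fin d₂)) (u g) =
    Matrix.toEuclideanLin S ((g.1 : Euc (Fin d₁ ⊕ Fin d₂)) x₀ - x₀)}
  add_mem' := by
    rintro u v ⟨A, hA, ha⟩ ⟨B, hB, hb⟩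
    refine ⟨A + B, Submodule.add_mem _ hA hB, fun g => ?_⟩
    rw [PiLp.add_apply, map_add, ha, hb, map_add, LinearMap.add_apply]
  zero_mem' := ⟨0, Submodule.zero_mem _, fun g => by
    rw [PiLp.zero_apply, map_zero, map_zero, LinearMap.zero_apply]⟩
  smul_mem' := by
    rintro c u ⟨A, hA, ha⟩
    refine ⟨c • A, Submodule.smul_mem _ c hA, fun g => ?_⟩
    rw [PiLp.smul_apply, map_smul, ha, map_smul, LinearMap.smul_apply]

/-- `U_{iso,0,0}(R) = U_trans(R) + U_{rot,0,0}(R)`. -/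
def UisoZZ (x₀ : Vec (Fin d₁ ⊕ Fin d₂)) (R : Finset G) : Submodule ℝ (LocalDisp R) :=
  Utrans R ⊔ UrotZZ x₀ R

/-- The restriction `u(g ·)|_R`. -/
def localDisp (u : G → Vec (Fin d₁ ⊕ Fin d₂)) (R : Finset G) (g : G) : LocalDisp R :=
  WithLp.toLp 2 fun h : R => u (g * h.1)

/-- The seminorm `‖u‖_{R,0,0} = (|C_N|⁻¹ ∑_{g ∈ C_N} ‖π(u(g ·)|_R)‖²)^{1/2}`, where `π` is the
orthogonal projection with kernel `U_{iso,0,0}(R)`. -/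
def seminormZZ (T : Set G) (x₀ : Vec (Fin d₁ ⊕ Fin d₂)) (R : Finset G)
    (u : G → Vec (Fin d₁ ⊕ Fin d₂)) : ℝ :=
  Real.sqrt (cellMean (powGroup T (period T u)) fun g =>
    ‖(UisoZZ x₀ R)ᗮ.starProjection (localDisp u R g)‖ ^ 2)

/-- The stability constant
`λ_{a,0,0} = sup {c ∈ ℝ | ∀ u ∈ U_per, c ‖u‖_{R,0,0}² ≤ E''(x₀)(u, u)}`, an extended real. -/
def stabilityConstant (T : Set G) (V : Config G → ℝ) (x₀ : Vec (Fin d₁ ⊕ Fin d₂))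
    (R : Finset G) : EReal :=
  sSup ((fun c : ℝ => (c : EReal)) '' {c : ℝ | ∀ u : Uper T (Vec (Fin d₁ ⊕ Fin d₂)),
    c * seminormZZ T x₀ R (fun g => u.1 g) ^ 2 ≤ energyHessian T V x₀ u})

/-- Property 1: `R` is finite, `id ∈ R` and `aff(R · x₀) = aff(G · x₀)`. -/
def PropertyOne (x₀ : Vec (Fin d₁ ⊕ Fin d₂)) (R : Set G) : Prop :=
  R.Finite ∧ 1 ∈ R ∧ affineSpan ℝ ((fun g : G => (g : Euc (Fin d₁ ⊕ Fin d₂)) x₀) '' R) =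
    affineSpan ℝ (Set.range fun g : G => (g : Euc (Fin d₁ ⊕ Fin d₂)) x₀)

/-- Property 2: `R` is finite and there are `R', R'' ⊆ G` such that `id ∈ R'`, `R'` generates `G`,
`R''` has Property 1 and `R' R'' ⊆ R`. -/
def PropertyTwo (x₀ : Vec (Fin d₁ ⊕ Fin d₂)) (R : Finset G) : Prop :=
  ∃ R' R'' : Set G, 1 ∈ R' ∧ Subgroup.closure R' = ⊤ ∧ PropertyOne x₀ R'' ∧ R' * R'' ⊆ (R : Set G)

end Seminorm

end ObjStruct

end

/-! ### Means of periodic functions -/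

namespace ObjStruct

section Means

variable {Γ : Type} [Group Γ]

/-! By orthogonal invariance and finite range, `E(x₀ + u)` is the mean over `g` of `F(y₀ + L_g u)`,
where `F` is a C² function on a finite-dimensional space and `L_g u = (rot(h) u(gh) - u(g))_h`
(`displacedEnergy_eq_mean`). The mean is invariant under right translation of `g`, so the first
variation at `u` is the mean of `e_V · u(g)` and vanishes (`mean_first_variation`). The second
variation is the mean of `F''(y₀)(L_g u, L_g u)` (`fderiv_fderiv_mean`). Since `‖L_g u‖ ≤ 2‖u‖`,
Taylor's formula for `F` holds with an error `ε ‖L_g u‖²`, uniformly in `g`. If `a > 0` and `a q(u)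
≤ E''(x₀)(u, u)` with `q(u) = ‖u‖²_{R,0,0}`, then `E(x₀ + u) - E(x₀) ≥ (a/2) q(u) - ε · mean ‖L_g
u‖²` for small `u`. So a bound `mean ‖L_g u‖² ≤ K q(u)` is enough
(`exists_forall_displacedEnergy_le`), and this is where the restriction on `d₁` enters.

If `d₁ ≤ 1`, there are no skew matrices `S₁ ≠ 0`, so `q` measures the deviation from translations
alone. It controls `rot(h) u(gh) - u(g)` for `h ∈ R`, and telescoping reaches every `h` because `R`
generates the group (`exists_mean_relDisp_le_of_le_one`).

If `d₁ = d`, the group is finite, and the bound can fail for infinitesimal rotations, which `q` does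
not see. But a rigid motion of the whole structure does not change the energy, and the motion that
best aligns the deformed structure with the reference makes the displacement orthogonal to all
infinitesimal isometries (`exists_aligned_displacement`). On that subspace `q` is positive definite,
because a displacement which is an infinitesimal isometry on every translate of `R` is one globally
(`exists_skew_of_forall_localDisp_mem`). Finite dimension then gives the bound. -/

theorem cellMean_add (H : Subgroup Γ) [H.FiniteIndex] (f₁ f₂ : Γ → ℝ) :
    cellMean H (fun g => f₁ g + f₂ g) = cellMean H f₁ + cellMean H f₂ := by
  unfold cellMean
  rw [finsum_add_distrib (Set.toFinite _) (Set.toFinite _), mul_add]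

theorem cellMean_const_mul (H : Subgroup Γ) [H.FiniteIndex] (c : ℝ) (f : Γ → ℝ) :
    cellMean H (fun g => c * f g) = c * cellMean H f := by
  unfold cellMean
  rw [← mul_finsum (fun q : Γ ⧸ H => f q.out) c]
  ring

theorem cellMean_sub (H : Subgroup Γ) [H.FiniteIndex] (f₁ f₂ : Γ → ℝ) :
    cellMean H (fun g => f₁ g - f₂ g) = cellMean H f₁ - cellMean H f₂ := by
  unfold cellMean
  rw [finsum_sub_distrib (Set.toFinite _) (Set.toFinite _), mul_sub]

theorem cellMean_sum (H : Subgroup Γ) [H.FiniteIndex] {ι : Type} (s : Finset ι) (f : ι → Γ → ℝ) :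
    cellMean H (fun g => ∑ i ∈ s, f i g) = ∑ i ∈ s, cellMean H (f i) := by
  classical
  induction s using Finset.induction_on with
  | empty => simp [cellMean]
  | insert a s ha ih =>
    simp only [Finset.sum_insert ha]
    rw [cellMean_add, ih]

theorem cellMean_mono (H : Subgroup Γ) [H.FiniteIndex] {f₁ f₂ : Γ → ℝ} (h : ∀ g, f₁ g ≤ f₂ g) :
    cellMean H f₁ ≤ cellMean H f₂ := by
  unfold cellMean
  exact mul_le_mul_of_nonneg_left
    (finsum_le_finsum' (Set.toFinite _) (Set.toFinite _) fun _ => h _) (by positivity)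

theorem cellMean_const (H : Subgroup Γ) [H.FiniteIndex] (c : ℝ) :
    cellMean H (fun _ => c) = c := by
  have := Fintype.ofFinite (Γ ⧸ H)
  unfold cellMean
  rw [finsum_eq_sum_of_fintype, Finset.sum_const, Finset.card_univ, Nat.card_eq_fintype_card,
    nsmul_eq_mul, ← mul_assoc, inv_mul_cancel₀ (by exact_mod_cast Fintype.card_ne_zero), one_mul]

theorem cellMean_nonneg (H : Subgroup Γ) [H.FiniteIndex] {f : Γ → ℝ} (h : ∀ g, 0 ≤ f g) :
    0 ≤ cellMean H f :=
  (cellMean_const H 0).symm.le.trans (cellMean_mono H h)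

theorem abs_cellMean_le (H : Subgroup Γ) [H.FiniteIndex] {f : Γ → ℝ} {c : ℝ}
    (h : ∀ g, |f g| ≤ c) : |cellMean H f| ≤ c := by
  rw [abs_le]
  constructor
  · rw [← cellMean_const H (-c)]
    exact cellMean_mono H fun g => (abs_le.1 (h g)).1
  · conv_rhs => rw [← cellMean_const H c]
    exact cellMean_mono H fun g => (abs_le.1 (h g)).2

theorem apply_quotient_out {X : Type} {H : Subgroup Γ} {f : Γ → X}
    (hf : ∀ g, ∀ t ∈ H, f g = f (g * t)) (g : Γ) : f ((g : Γ ⧸ H).out) = f g := by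
  obtain ⟨t, ht⟩ := QuotientGroup.mk_out_eq_mul H g
  rw [ht, ← hf g t t.2]

/-- Normality makes right multiplication by `h` a permutation of the cosets and keeps the translated
function `H`-invariant. -/
theorem cellMean_comp_mul_right (H : Subgroup Γ) [H.Normal] {f : Γ → ℝ}
    (hf : ∀ g, ∀ t ∈ H, f g = f (g * t)) (h : Γ) :
    cellMean H (fun g => f (g * h)) = cellMean H f := by
  unfold cellMean
  congr 1
  refine (finsum_congr fun q => ?_).trans
    (finsum_comp_equiv (Equiv.mulRight (h : Γ ⧸ H)) (f := fun q => f q.out))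
  obtain ⟨g, rfl⟩ := QuotientGroup.mk_surjective q
  simp only [Equiv.coe_mulRight, ← QuotientGroup.mk_mul]
  rw [apply_quotient_out hf]
  refine apply_quotient_out (f := fun g => f (g * h)) (fun g t ht => ?_) g
  have := hf (g * h) (h⁻¹ * t * h) (by simpa using ‹H.Normal›.conj_mem t ht h⁻¹)
  simpa [mul_assoc] using this

/-- Under `Γ ⧸ K ≃ (Γ ⧸ H) × (H ⧸ K)` every value is repeated `[H : K]` times, which the
normalization cancels. -/
theorem cellMean_eq_of_le {K H : Subgroup Γ} [K.FiniteIndex] [H.FiniteIndex] (hKH : K ≤ H)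
    {f : Γ → ℝ} (hf : ∀ g, ∀ t ∈ H, f g = f (g * t)) : cellMean K f = cellMean H f := by
  have := Fintype.ofFinite (Γ ⧸ K)
  have := Fintype.ofFinite (Γ ⧸ H)
  have : Finite ((Γ ⧸ H) × H ⧸ K.subgroupOf H) :=
    Finite.of_equiv _ (Subgroup.quotientEquivProdOfLE hKH)
  have : Finite (H ⧸ K.subgroupOf H) :=
    Finite.of_surjective (Prod.snd : (Γ ⧸ H) × (H ⧸ K.subgroupOf H) → _) Prod.snd_surjective
  have := Fintype.ofFinite (H ⧸ K.subgroupOf H)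
  have key : ∀ q : Γ ⧸ K, f q.out =
      (fun p : (Γ ⧸ H) × H ⧸ K.subgroupOf H => f p.1.out) (Subgroup.quotientEquivProdOfLE hKH q) := by
    intro q
    obtain ⟨g, rfl⟩ := QuotientGroup.mk_surjective q
    rw [apply_quotient_out fun g t ht => hf g t (hKH ht)]
    exact (apply_quotient_out hf g).symm
  unfold cellMean
  rw [finsum_congr key, finsum_comp_equiv (Subgroup.quotientEquivProdOfLE hKH)
    (f := fun p : (Γ ⧸ H) × H ⧸ K.subgroupOf H => f p.1.out), finsum_eq_sum_of_fintype, finsum_eq_sum_of_fintype,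
    Fintype.sum_prod_type, Nat.card_congr (Subgroup.quotientEquivProdOfLE hKH), Nat.card_prod]
  simp only [Finset.sum_const, Finset.card_univ, Nat.card_eq_fintype_card, nsmul_eq_mul]
  rw [← Finset.mul_sum]
  have h1 : (Fintype.card (H ⧸ K.subgroupOf H) : ℝ) ≠ 0 := by exact_mod_cast Fintype.card_ne_zero
  push_cast
  field_simp

/-- Both means equal the one over `K ⊓ H`. This makes the energy and the seminorm independent of the
chosen period. -/
theorem cellMean_eq_of_invariant {K H : Subgroup Γ} [K.FiniteIndex] [H.FiniteIndex]
    {f : Γ → ℝ} (hK : ∀ g, ∀ t ∈ K, f g = f (g * t)) (hH : ∀ g, ∀ t ∈ H, f g = f (g * t)) :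
    cellMean K f = cellMean H f := by
  rw [← cellMean_eq_of_le (inf_le_left : K ⊓ H ≤ K) hK,
    cellMean_eq_of_le (inf_le_right : K ⊓ H ≤ H) hH]

/-! ### Periodic functions and their period-independent mean -/

/-- The groups `T^N`, `N` admissible, have finite index and form a directed family. -/
structure HasCommonPeriods (T : Set Γ) : Prop where
  finiteIndex : ∀ N, Admissible T N → (powGroup T N).FiniteIndex
  directed : ∀ N M, Admissible T N → Admissible T M →
    ∃ K, Admissible T K ∧ powGroup T K ≤ powGroup T N ∧ powGroup T K ≤ powGroup T M

/-- `u` is `T^N`-periodic for some admissible `N`. -/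
def IsPeriodic {X : Type} (T : Set Γ) (u : Γ → X) : Prop :=
  ∃ N, Admissible T N ∧ PeriodicWith T N u

theorem IsPeriodic.period_spec {X : Type} {T : Set Γ} {u : Γ → X} (hu : IsPeriodic T u) :
    Admissible T (period T u) ∧ PeriodicWith T (period T u) u :=
  Nat.sInf_mem hu

theorem PeriodicWith.comp {X Y : Type} {T : Set Γ} {N : ℕ} {u : Γ → X} (hu : PeriodicWith T N u)
    (φ : X → Y) : PeriodicWith T N fun g => φ (u g) :=
  fun g t ht => congrArg φ (hu g t ht)

theorem IsPeriodic.comp {X Y : Type} {T : Set Γ} {u : Γ → X} (hu : IsPeriodic T u) (φ : X → Y) :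
    IsPeriodic T fun g => φ (u g) :=
  let ⟨N, hN, h⟩ := hu
  ⟨N, hN, h.comp φ⟩

/-- Directedness gives a common period; pairing lets any pointwise combination of two periodic
functions inherit it through `IsPeriodic.comp`. -/
theorem IsPeriodic.prodMk {X Y : Type} {T : Set Γ} (hT : HasCommonPeriods T) {u : Γ → X}
    {v : Γ → Y} (hu : IsPeriodic T u) (hv : IsPeriodic T v) :
    IsPeriodic T fun g => (u g, v g) := by
  obtain ⟨N, hN, hu⟩ := hu
  obtain ⟨M, hM, hv⟩ := hv
  obtain ⟨K, hK, hKN, hKM⟩ := hT.directed N M hN hM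
  exact ⟨K, hK, fun g t ht => Prod.ext (hu g t (hKN ht)) (hv g t (hKM ht))⟩

theorem IsPeriodic.comp₂ {X Y Z : Type} {T : Set Γ} (hT : HasCommonPeriods T) {u : Γ → X}
    {v : Γ → Y} (hu : IsPeriodic T u) (hv : IsPeriodic T v) (φ : X → Y → Z) :
    IsPeriodic T fun g => φ (u g) (v g) :=
  (hu.prodMk hT hv).comp fun p => φ p.1 p.2

theorem PeriodicWith.mul_right {X : Type} {T : Set Γ} {N : ℕ} (hN : Admissible T N) {u : Γ → X}
    (hu : PeriodicWith T N u) (h : Γ) : PeriodicWith T N fun g => u (g * h) := by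
  intro g t ht
  have := hu (g * h) (h⁻¹ * t * h) (by simpa using hN.2.2.conj_mem t ht h⁻¹)
  simpa [mul_assoc] using this

theorem IsPeriodic.mul_right {X : Type} {T : Set Γ} {u : Γ → X} (hu : IsPeriodic T u) (h : Γ) :
    IsPeriodic T fun g => u (g * h) :=
  let ⟨N, hN, hu⟩ := hu
  ⟨N, hN, hu.mul_right hN h⟩

theorem IsPeriodic.finite_range {X : Type} {T : Set Γ} (hT : HasCommonPeriods T) {u : Γ → X}
    (hu : IsPeriodic T u) : (Set.range u).Finite := by
  obtain ⟨N, hN, hu⟩ := hu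
  have := hT.finiteIndex N hN
  refine (Set.finite_range fun q : Γ ⧸ powGroup T N => u q.out).subset ?_
  rintro _ ⟨g, rfl⟩
  exact ⟨g, apply_quotient_out hu g⟩

/-- The mean of a periodic function. -/
noncomputable def mean (T : Set Γ) (f : Γ → ℝ) : ℝ := cellMean (powGroup T (period T f)) f

theorem mean_eq_cellMean {T : Set Γ} (hT : HasCommonPeriods T) {N : ℕ} (hN : Admissible T N)
    {f : Γ → ℝ} (hf : PeriodicWith T N f) : mean T f = cellMean (powGroup T N) f := by
  obtain ⟨h1, h2⟩ := IsPeriodic.period_spec ⟨N, hN, hf⟩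
  have := hT.finiteIndex _ h1
  have := hT.finiteIndex _ hN
  exact cellMean_eq_of_invariant h2 hf

/-- The energy and the seminorm average over the period of `u`, whereas `mean` uses the period of
the integrand, which may be smaller. -/
theorem cellMean_period_eq_mean {X : Type} {T : Set Γ} (hT : HasCommonPeriods T) {u : Γ → X}
    (hu : IsPeriodic T u) {f : Γ → ℝ}
    (hf : ∀ N, Admissible T N → PeriodicWith T N u → PeriodicWith T N f) :
    cellMean (powGroup T (period T u)) f = mean T f :=
  (mean_eq_cellMean hT hu.period_spec.1 (hf _ hu.period_spec.1 hu.period_spec.2)).symm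

theorem mean_add {T : Set Γ} (hT : HasCommonPeriods T) {f₁ f₂ : Γ → ℝ} (h₁ : IsPeriodic T f₁)
    (h₂ : IsPeriodic T f₂) : mean T (fun g => f₁ g + f₂ g) = mean T f₁ + mean T f₂ := by
  obtain ⟨N, hN, h⟩ := h₁.prodMk hT h₂
  have := hT.finiteIndex N hN
  rw [mean_eq_cellMean hT hN (h.comp fun p => p.1 + p.2),
    mean_eq_cellMean hT hN (h.comp fun p => p.1), mean_eq_cellMean hT hN (h.comp fun p => p.2),
    cellMean_add]

theorem mean_const_mul {T : Set Γ} (hT : HasCommonPeriods T) (c : ℝ) {f : Γ → ℝ}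
    (h : IsPeriodic T f) : mean T (fun g => c * f g) = c * mean T f := by
  obtain ⟨N, hN, h⟩ := h
  have := hT.finiteIndex N hN
  rw [mean_eq_cellMean hT hN (h.comp fun p => c * p), mean_eq_cellMean hT hN h,
    cellMean_const_mul]

theorem mean_sub {T : Set Γ} (hT : HasCommonPeriods T) {f₁ f₂ : Γ → ℝ} (h₁ : IsPeriodic T f₁)
    (h₂ : IsPeriodic T f₂) : mean T (fun g => f₁ g - f₂ g) = mean T f₁ - mean T f₂ := by
  obtain ⟨N, hN, h⟩ := h₁.prodMk hT h₂
  have := hT.finiteIndex N hN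
  rw [mean_eq_cellMean hT hN (h.comp fun p => p.1 - p.2),
    mean_eq_cellMean hT hN (h.comp fun p => p.1), mean_eq_cellMean hT hN (h.comp fun p => p.2),
    cellMean_sub]

theorem mean_mono {T : Set Γ} (hT : HasCommonPeriods T) {f₁ f₂ : Γ → ℝ} (h₁ : IsPeriodic T f₁)
    (h₂ : IsPeriodic T f₂) (h : ∀ g, f₁ g ≤ f₂ g) : mean T f₁ ≤ mean T f₂ := by
  obtain ⟨N, hN, hp⟩ := h₁.prodMk hT h₂
  have := hT.finiteIndex N hN
  rw [mean_eq_cellMean hT hN (hp.comp fun p => p.1), mean_eq_cellMean hT hN (hp.comp fun p => p.2)]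
  exact cellMean_mono _ h

theorem mean_nonneg {T : Set Γ} (hT : HasCommonPeriods T) {f : Γ → ℝ} (hf : IsPeriodic T f)
    (h : ∀ g, 0 ≤ f g) : 0 ≤ mean T f := by
  obtain ⟨N, hN, hp⟩ := hf
  have := hT.finiteIndex N hN
  rw [mean_eq_cellMean hT hN hp]
  exact cellMean_nonneg _ h

theorem abs_mean_le {T : Set Γ} (hT : HasCommonPeriods T) {f : Γ → ℝ} (hf : IsPeriodic T f)
    {c : ℝ} (h : ∀ g, |f g| ≤ c) : |mean T f| ≤ c := by
  obtain ⟨N, hN, hp⟩ := hf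
  have := hT.finiteIndex N hN
  rw [mean_eq_cellMean hT hN hp]
  exact abs_cellMean_le _ h

theorem mean_sum {T : Set Γ} (hT : HasCommonPeriods T) {X ι : Type} {u : Γ → X}
    (hu : IsPeriodic T u) (s : Finset ι) {f : ι → Γ → ℝ}
    (hf : ∀ i, ∀ N, Admissible T N → PeriodicWith T N u → PeriodicWith T N (f i)) :
    mean T (fun g => ∑ i ∈ s, f i g) = ∑ i ∈ s, mean T (f i) := by
  obtain ⟨N, hN, hp⟩ := hu
  have := hT.finiteIndex N hN
  rw [mean_eq_cellMean hT hN (fun g t ht => Finset.sum_congr rfl fun i _ => hf i N hN hp g t ht),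
    cellMean_sum]
  exact Finset.sum_congr rfl fun i _ => (mean_eq_cellMean hT hN (hf i N hN hp)).symm

theorem mean_comp_mul_right {T : Set Γ} (hT : HasCommonPeriods T) {f : Γ → ℝ}
    (hf : IsPeriodic T f) (h : Γ) : mean T (fun g => f (g * h)) = mean T f := by
  obtain ⟨N, hN, hp⟩ := hf
  have := hN.2.2
  rw [mean_eq_cellMean hT hN hp, mean_eq_cellMean hT hN (hp.mul_right hN h),
    cellMean_comp_mul_right _ hp]

variable {E : Type} [NormedAddCommGroup E] [NormedSpace ℝ E]

theorem isPeriodic_of_mem_Uper {T : Set Γ} (hT : HasCommonPeriods T)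
    (hne : ∃ N, Admissible T N) {u : Bdd Γ E} (hu : u ∈ Uper T E) :
    IsPeriodic T fun g => u g := by
  have : Nonempty {N : ℕ // Admissible T N} := let ⟨N, hN⟩ := hne; ⟨⟨N, hN⟩⟩
  have hdir : Directed (· ≤ ·) fun N : {N : ℕ // Admissible T N} => UperN T E (N : ℕ) := by
    intro N M
    obtain ⟨K, hK, h1, h2⟩ := hT.directed N M N.2 M.2
    exact ⟨⟨K, hK⟩, fun v hv g t ht => hv g t (h1 ht), fun v hv g t ht => hv g t (h2 ht)⟩
  obtain ⟨N, hN⟩ := (Submodule.mem_iSup_of_directed _ hdir).1 hu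
  exact ⟨N, N.2, hN⟩

theorem mem_Uper_of_periodicWith {T : Set Γ} {N : ℕ} (hN : Admissible T N) {u : Bdd Γ E}
    (hu : PeriodicWith T N fun g => u g) : u ∈ Uper T E :=
  (le_iSup (fun N : {N : ℕ // Admissible T N} => UperN T E (N : ℕ)) ⟨N, hN⟩ :) hu

theorem Uper_eq_bot {T : Set Γ} (h : ¬ ∃ N, Admissible T N) : Uper T E = ⊥ := by
  have : IsEmpty {N : ℕ // Admissible T N} := ⟨fun N => h ⟨N, N.2⟩⟩
  exact iSup_of_empty _

end Means

end ObjStruct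

/-! ### The translation sections of space groups -/

namespace ObjStruct

section Geometry

variable {d₁ d₂ : ℕ}

/-- `π(g)` is the translation by `v`. -/
def HasShift (g : Euc (Fin d₁ ⊕ Fin d₂)) (v : Vec (Fin d₂)) : Prop :=
  ∀ x, sndPart (g x) = sndPart x + v

theorem norm_le_norm_fstPart_add (x : Vec (Fin d₁ ⊕ Fin d₂)) :
    ‖x‖ ≤ ‖fstPart x‖ + ‖sndPart x‖ := by
  have h : ‖x‖ ^ 2 = ‖fstPart x‖ ^ 2 + ‖sndPart x‖ ^ 2 := by
    simp only [EuclideanSpace.norm_sq_eq, Fintype.sum_sum_type]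
    rfl
  nlinarith [norm_nonneg x, norm_nonneg (fstPart x), norm_nonneg (sndPart x)]

theorem euc_apply {ι : Type} [Fintype ι] (g : Euc ι) (x : Vec ι) :
    g x = rot g x + trans g := by
  have := g.map_vadd 0 x
  simpa [rot, trans] using this

theorem euc_sub {ι : Type} [Fintype ι] (g : Euc ι) (x y : Vec ι) :
    g x - g y = rot g (x - y) := by
  rw [euc_apply, euc_apply g y, map_sub]
  abel

theorem euc_add {ι : Type} [Fintype ι] (g : Euc ι) (x y : Vec ι) :
    g (x + y) = g x + rot g y := by
  rw [euc_apply, euc_apply g x, map_add]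
  abel

theorem rot_mul {ι : Type} [Fintype ι] (g h : Euc ι) (x : Vec ι) :
    rot (g * h) x = rot g (rot h x) := rfl

theorem rot_one {ι : Type} [Fintype ι] (x : Vec ι) : rot (1 : Euc ι) x = x := rfl

theorem rot_inv_rot {ι : Type} [Fintype ι] (g : Euc ι) (x : Vec ι) :
    rot g⁻¹ (rot g x) = x := by
  rw [← rot_mul, inv_mul_cancel, rot_one]

theorem IsTranslation.apply {ι : Type} [Fintype ι] {s : Euc ι} (hs : IsTranslation s)
    (x : Vec ι) : s x = x + trans s := by
  rw [euc_apply, show rot s = 1 from hs]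
  rfl

theorem IsTranslation.eq {ι : Type} [Fintype ι] {s s' : Euc ι} (hs : IsTranslation s)
    (hs' : IsTranslation s') (h : trans s = trans s') : s = s' := by
  ext1 x
  rw [hs.apply, hs'.apply, h]

theorem HasShift.mul {g h : Euc (Fin d₁ ⊕ Fin d₂)} {v w : Vec (Fin d₂)} (hg : HasShift g v)
    (hh : HasShift h w) : HasShift (g * h) (v + w) := by
  intro x
  rw [AffineIsometryEquiv.coe_mul, Function.comp_apply, hg, hh, add_assoc, add_comm w]

theorem HasShift.pow {g : Euc (Fin d₁ ⊕ Fin d₂)} {v : Vec (Fin d₂)} (hg : HasShift g v) (n : ℕ) :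
    HasShift (g ^ n) (n • v) := by
  induction n with
  | zero => intro x; simp
  | succ n ih => rw [pow_succ, succ_nsmul]; exact ih.mul hg

theorem HasShift.unique {g : Euc (Fin d₁ ⊕ Fin d₂)} {v w : Vec (Fin d₂)} (hv : HasShift g v)
    (hw : HasShift g w) : v = w := by
  have := (hv 0).symm.trans (hw 0)
  exact add_left_cancel this

theorem hasShift_of_projectsTo {g : Euc (Fin d₁ ⊕ Fin d₂)} {s : Euc (Fin d₂)}
    (hs : IsTranslation s) (hg : ProjectsTo g s) : HasShift g (trans s) := by
  obtain ⟨A, hA⟩ := hg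
  intro x
  rw [(hA x).2, hs.apply]

/-- The translation lattice of `S`. -/
def shiftLattice (S : Subgroup (Euc (Fin d₂))) : AddSubgroup (Vec (Fin d₂)) where
  carrier := {v | ∃ s ∈ S, IsTranslation s ∧ trans s = v}
  zero_mem' := ⟨1, S.one_mem, rfl, rfl⟩
  add_mem' := by
    rintro _ _ ⟨s, hs, hs', rfl⟩ ⟨r, hr, hr', rfl⟩
    refine ⟨r * s, S.mul_mem hr hs, ?_, hr'.apply (s 0)⟩
    ext1 x
    rw [rot_mul, show rot r = 1 from hr', show rot s = 1 from hs']
    rfl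
  neg_mem' := by
    rintro _ ⟨s, hs, hs', rfl⟩
    have h1 : IsTranslation s⁻¹ := by
      refine LinearIsometryEquiv.ext fun x => ?_
      have h2 := rot_inv_rot s x
      rw [show rot s = 1 from hs'] at h2
      exact h2
    refine ⟨s⁻¹, S.inv_mem hs, h1, ?_⟩
    have h2 := h1.apply (s 0)
    rw [← Function.comp_apply (f := ⇑s⁻¹), ← AffineIsometryEquiv.coe_mul, inv_mul_cancel] at h2
    exact eq_neg_of_add_eq_zero_right h2.symm

/-- The lattice dilated by `N` is still cocompact: subtract `N` times the integer part of `y / N`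
with respect to a basis of lattice vectors. What remains is `N` times a fractional part. -/
theorem exists_shiftLattice_near {S : Subgroup (Euc (Fin d₂))} (hS : IsSpaceGroup S) {N : ℕ}
    (hN : 0 < N) : ∃ C : ℝ, ∀ y : Vec (Fin d₂), ∃ v ∈ shiftLattice S, ‖y + N • v‖ ≤ C := by
  obtain ⟨-, t, ht, hli⟩ := hS
  let b := basisOfLinearIndependentOfCardEqFinrank' (fun i => trans (t i)) hli (by simp)
  refine ⟨N * ∑ i, ‖b i‖, fun y => ?_⟩
  let m : Vec (Fin d₂) := (N : ℝ)⁻¹ • y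
  have hle : Submodule.span ℤ (Set.range b) ≤ AddSubgroup.toIntSubmodule (shiftLattice S) := by
    rw [Submodule.span_le]
    rintro _ ⟨i, rfl⟩
    exact ⟨t i, (ht i).1, (ht i).2, by simp [b]⟩
  refine ⟨-(ZSpan.floor b m : Vec (Fin d₂)), neg_mem (hle (ZSpan.floor b m).2), ?_⟩
  have hN' : (N : ℝ) ≠ 0 := by exact_mod_cast hN.ne'
  have h1 : y + N • -(ZSpan.floor b m : Vec (Fin d₂)) = (N : ℝ) • ZSpan.fract b m := by
    rw [ZSpan.fract_apply, smul_sub, smul_inv_smul₀ hN', smul_neg, sub_eq_add_neg,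
      Nat.cast_smul_eq_nsmul]
  rw [h1, norm_smul, Real.norm_natCast]
  exact mul_le_mul_of_nonneg_left (ZSpan.norm_fract_le b m) (by positivity)

/-- One isolating radius at `x₀` serves at all orbit points, since the group acts by isometries. The
orbit is therefore uniformly separated, hence closed, and meets each ball in a finite set;
injectivity carries this back to the group. -/
theorem finite_setOf_norm_apply_le {G : Subgroup (Euc (Fin d₁ ⊕ Fin d₂))}
    (hG : IsDiscreteGroup G) {x₀ : Vec (Fin d₁ ⊕ Fin d₂)}
    (hx₀ : Function.Injective fun g : G => (g : Euc (Fin d₁ ⊕ Fin d₂)) x₀) (C : ℝ) :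
    {g : G | ‖(g : Euc (Fin d₁ ⊕ Fin d₂)) x₀‖ ≤ C}.Finite := by
  have hd := hG x₀
  obtain ⟨U, hU, hUx⟩ := isDiscrete_iff_forall_mem_exists_isOpen.1 hd x₀ ⟨1, rfl⟩
  have hxU : x₀ ∈ U := (hUx.ge rfl).1
  obtain ⟨ε, hε, hball⟩ := Metric.isOpen_iff.1 hU x₀ hxU
  have hcl : IsClosed (Set.range fun g : G => (g : Euc (Fin d₁ ⊕ Fin d₂)) x₀) := by
    refine Metric.isClosed_of_pairwise_le_dist hε ?_
    rintro _ ⟨g, rfl⟩ _ ⟨h, rfl⟩ hne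
    by_contra hlt
    rw [not_le] at hlt
    have h1 : dist (((h⁻¹ * g : G) : Euc (Fin d₁ ⊕ Fin d₂)) x₀) x₀ < ε := by
      have h2 : (h : Euc (Fin d₁ ⊕ Fin d₂)) (((h⁻¹ * g : G) : Euc (Fin d₁ ⊕ Fin d₂)) x₀) =
          (g : Euc (Fin d₁ ⊕ Fin d₂)) x₀ := by
        rw [← Function.comp_apply (f := ⇑(h : Euc (Fin d₁ ⊕ Fin d₂))),
          ← AffineIsometryEquiv.coe_mul, ← Subgroup.coe_mul, mul_inv_cancel_left]
      rw [← (h : Euc (Fin d₁ ⊕ Fin d₂)).dist_map, h2]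
      exact hlt
    have h2 : ((h⁻¹ * g : G) : Euc (Fin d₁ ⊕ Fin d₂)) x₀ ∈ ({x₀} : Set _) := by
      rw [← hUx]
      exact ⟨hball h1, ⟨_, rfl⟩⟩
    have h3 : h⁻¹ * g = 1 := hx₀ (a₁ := h⁻¹ * g) (a₂ := 1) h2
    exact hne (by rw [inv_mul_eq_one.1 h3])
  have hfin := Metric.finite_isBounded_inter_isClosed hd
    (Metric.isBounded_closedBall (x := (0 : Vec (Fin d₁ ⊕ Fin d₂))) (r := C)) hcl
  refine Set.Finite.of_finite_image (f := fun g : G => (g : Euc (Fin d₁ ⊕ Fin d₂)) x₀)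
    (hfin.subset ?_) hx₀.injOn
  rintro _ ⟨g, hg, rfl⟩
  exact ⟨mem_closedBall_zero_iff.2 hg, g, rfl⟩

theorem norm_fstPart_apply {G : Subgroup (Euc (Fin d₁ ⊕ Fin d₂))}
    {S : Subgroup (Euc (Fin d₂))} (hGS : IsSubgroupOver G S) (g : G)
    (x : Vec (Fin d₁ ⊕ Fin d₂)) : ‖fstPart ((g : Euc (Fin d₁ ⊕ Fin d₂)) x)‖ = ‖fstPart x‖ := by
  obtain ⟨h, -, A, hA⟩ := hGS.1 g g.2
  rw [(hA x).1, A.norm_map]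

section Section

variable {G : Subgroup (Euc (Fin d₁ ⊕ Fin d₂))} {S : Subgroup (Euc (Fin d₂))} {T : Set G}

theorem IsTranslationSection.exists_hasShift (hT : IsTranslationSection G S T) {t : G}
    (ht : t ∈ T) : ∃ v, HasShift (t : Euc (Fin d₁ ⊕ Fin d₂)) v :=
  let ⟨_, _, hs, hts⟩ := hT.1 t ht
  ⟨_, hasShift_of_projectsTo hs hts⟩

theorem IsTranslationSection.exists_mem (hT : IsTranslationSection G S T) {v : Vec (Fin d₂)}
    (hv : v ∈ shiftLattice S) : ∃ t ∈ T, HasShift (t : Euc (Fin d₁ ⊕ Fin d₂)) v := by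
  obtain ⟨s, hs, hs', rfl⟩ := hv
  obtain ⟨t, ⟨ht, hts⟩, -⟩ := hT.2 s hs hs'
  exact ⟨t, ht, hasShift_of_projectsTo hs' hts⟩

theorem IsTranslationSection.eq_of_hasShift (hT : IsTranslationSection G S T) {t r : G}
    (ht : t ∈ T) (hr : r ∈ T) {v : Vec (Fin d₂)} (htv : HasShift (t : Euc (Fin d₁ ⊕ Fin d₂)) v)
    (hrv : HasShift (r : Euc (Fin d₁ ⊕ Fin d₂)) v) : t = r := by
  obtain ⟨s, hs, hs', hts⟩ := hT.1 t ht
  obtain ⟨q, hq, hq', hrq⟩ := hT.1 r hr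
  have hsq : s = q := hs'.eq hq' (((hasShift_of_projectsTo hs' hts).unique htv).trans
    (hrv.unique (hasShift_of_projectsTo hq' hrq)))
  exact (hT.2 s hs hs').unique ⟨ht, hts⟩ ⟨hr, hsq ▸ hrq⟩

theorem Admissible.mem_iff {Γ : Type} [Group Γ] {T : Set Γ} {N : ℕ} (hN : Admissible T N) {g : Γ} :
    g ∈ powGroup T N ↔ ∃ t ∈ T, t ^ N = g := by
  rw [← SetLike.mem_coe, hN.2.1]
  rfl

/-- Every coset has a representative sending `x₀` into a fixed ball: `T^N` can pull the second
component into a bounded region, while the norm of the first is invariant under the group. Only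
finitely many elements do this. -/
theorem IsTranslationSection.finiteIndex_powGroup (hT : IsTranslationSection G S T)
    (hS : IsSpaceGroup S) (hG : IsDiscreteGroup G) (hGS : IsSubgroupOver G S)
    {x₀ : Vec (Fin d₁ ⊕ Fin d₂)}
    (hx₀ : Function.Injective fun g : G => (g : Euc (Fin d₁ ⊕ Fin d₂)) x₀) {N : ℕ}
    (hN : Admissible T N) : (powGroup T N).FiniteIndex := by
  obtain ⟨C, hC⟩ := exists_shiftLattice_near hS hN.1
  have hfin := finite_setOf_norm_apply_le hG hx₀ (‖fstPart x₀‖ + C)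
  have := hfin.to_subtype
  have hsurj : Function.Surjective
      fun g : {g : G | ‖(g : Euc (Fin d₁ ⊕ Fin d₂)) x₀‖ ≤ ‖fstPart x₀‖ + C} =>
        ((g : G) : G ⧸ powGroup T N) := by
    intro q
    obtain ⟨g, rfl⟩ := QuotientGroup.mk_surjective q
    obtain ⟨v, hv, hvC⟩ := hC (sndPart ((g : Euc (Fin d₁ ⊕ Fin d₂)) x₀))
    obtain ⟨t, ht, htv⟩ := hT.exists_mem hv
    have hmem : t ^ N ∈ powGroup T N := hN.mem_iff.2 ⟨t, ht, rfl⟩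
    refine ⟨⟨t ^ N * g, ?_⟩, ?_⟩
    · refine (norm_le_norm_fstPart_add _).trans ?_
      rw [norm_fstPart_apply hGS]
      refine add_le_add_right ?_ _
      have := htv.pow N ((g : Euc (Fin d₁ ⊕ Fin d₂)) x₀)
      rw [Subgroup.coe_mul, Subgroup.coe_pow, AffineIsometryEquiv.coe_mul, Function.comp_apply,
        this]
      exact hvC
    -- The element was corrected on the left; by normality this does not change its left coset.
    · have h1 := hN.2.2.conj_mem _ hmem g⁻¹
      refine (QuotientGroup.eq.2 ?_).symm
      simpa [mul_assoc] using h1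
  have := Finite.of_surjective _ hsurj
  exact Subgroup.finiteIndex_of_finite_quotient

/-- Both `ab` and `ba` lie in `T^N`, say as `p ^ N` and `q ^ N`. Their projections are the same
translation, so `p` and `q` have equal shifts and coincide, as `T` is a section. -/
theorem IsTranslationSection.commute_of_mem_powGroup (hT : IsTranslationSection G S T) {N : ℕ}
    (hN : Admissible T N) {a b : G} (ha : a ∈ powGroup T N) (hb : b ∈ powGroup T N) :
    Commute a b := by
  obtain ⟨t, ht, hta⟩ := hN.mem_iff.1 ha
  obtain ⟨r, hr, hrb⟩ := hN.mem_iff.1 hb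
  obtain ⟨p, hp, hpab⟩ := hN.mem_iff.1 (mul_mem ha hb)
  obtain ⟨q, hq, hqba⟩ := hN.mem_iff.1 (mul_mem hb ha)
  obtain ⟨v, hv⟩ := hT.exists_hasShift ht
  obtain ⟨w, hw⟩ := hT.exists_hasShift hr
  obtain ⟨y, hy⟩ := hT.exists_hasShift hp
  obtain ⟨z, hz⟩ := hT.exists_hasShift hq
  have hav : HasShift (a : Euc (Fin d₁ ⊕ Fin d₂)) (N • v) := by
    rw [← hta]; exact hv.pow N
  have hbw : HasShift (b : Euc (Fin d₁ ⊕ Fin d₂)) (N • w) := by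
    rw [← hrb]; exact hw.pow N
  have hab : HasShift ((p : Euc (Fin d₁ ⊕ Fin d₂)) ^ N) (N • v + N • w) := by
    rw [← Subgroup.coe_pow, hpab]; exact hav.mul hbw
  have hba : HasShift ((q : Euc (Fin d₁ ⊕ Fin d₂)) ^ N) (N • w + N • v) := by
    rw [← Subgroup.coe_pow, hqba]; exact hbw.mul hav
  have hyz : N • y = N • z := by
    rw [(hy.pow N).unique hab, (hz.pow N).unique hba, add_comm]
  have hyz' : y = z := by
    rw [← Nat.cast_smul_eq_nsmul ℝ, ← Nat.cast_smul_eq_nsmul ℝ] at hyz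
    exact smul_right_injective _ (by exact_mod_cast hN.1.ne' : (N : ℝ) ≠ 0) hyz
  rw [commute_iff_eq, ← hpab, ← hqba, hT.eq_of_hasShift hp hq hy (hyz' ▸ hz)]

/-- `T^(NM)` is the set of `M`-th powers in the commutative group `T^N`, hence a subgroup, and
conjugation commutes with powers. -/
theorem IsTranslationSection.powGroup_mul (hT : IsTranslationSection G S T) {N : ℕ}
    (hN : Admissible T N) {M : ℕ} (hM : 0 < M) :
    Admissible T (N * M) ∧ powGroup T (N * M) ≤ powGroup T N := by
  have hset : (fun t : G => t ^ (N * M)) '' T = (fun t => t ^ M) '' (powGroup T N : Set G) := by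
    rw [hN.2.1, Set.image_image]
    simp only [pow_mul]
  let K : Subgroup G :=
    { carrier := (fun t => t ^ M) '' (powGroup T N : Set G)
      one_mem' := ⟨1, one_mem _, one_pow M⟩
      mul_mem' := by
        rintro _ _ ⟨a, ha, rfl⟩ ⟨b, hb, rfl⟩
        exact ⟨a * b, mul_mem ha hb, (hT.commute_of_mem_powGroup hN ha hb).mul_pow M⟩
      inv_mem' := by
        rintro _ ⟨a, ha, rfl⟩
        exact ⟨a⁻¹, inv_mem ha, inv_pow a M⟩ }
  have hK : powGroup T (N * M) = K := by
    rw [powGroup, hset]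
    exact Subgroup.closure_eq K
  refine ⟨⟨Nat.mul_pos hN.1 hM, ?_, ?_⟩, ?_⟩
  · rw [hK, hset]
    rfl
  · rw [hK]
    refine ⟨?_⟩
    rintro _ ⟨a, ha, rfl⟩ g
    exact ⟨g * a * g⁻¹, hN.2.2.conj_mem a ha g, conj_pow⟩
  · rw [hK]
    rintro _ ⟨a, ha, rfl⟩
    exact pow_mem ha M

theorem IsTranslationSection.hasCommonPeriods (hT : IsTranslationSection G S T)
    (hS : IsSpaceGroup S) (hG : IsDiscreteGroup G) (hGS : IsSubgroupOver G S)
    {x₀ : Vec (Fin d₁ ⊕ Fin d₂)}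
    (hx₀ : Function.Injective fun g : G => (g : Euc (Fin d₁ ⊕ Fin d₂)) x₀) :
    HasCommonPeriods T where
  finiteIndex _ hN := hT.finiteIndex_powGroup hS hG hGS hx₀ hN
  directed N M hN hM :=
    ⟨N * M, (hT.powGroup_mul hN hM.1).1, (hT.powGroup_mul hN hM.1).2, by
      rw [mul_comm]; exact (hT.powGroup_mul hM hN.1).2⟩

end Section

end Geometry

end ObjStruct

/-! ### Second derivatives of averaged superposition operators -/

namespace ObjStruct

section Analysis

/-- The derivative of the remainder at `x` is `o(‖x‖)` by differentiability of `F'` at `y`; the mean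
value inequality on the ball of radius `‖w‖` supplies the second factor. -/
theorem exists_taylor_two {W : Type} [NormedAddCommGroup W] [NormedSpace ℝ W] {F : W → ℝ}
    (hF : ContDiff ℝ 2 F) (y : W) {ε : ℝ} (hε : 0 < ε) :
    ∃ δ > 0, ∀ w : W, ‖w‖ ≤ δ →
      |F (y + w) - F y - fderiv ℝ F y w - fderiv ℝ (fderiv ℝ F) y w w / 2| ≤ ε * ‖w‖ ^ 2 := by
  have hdiff : Differentiable ℝ F := hF.differentiable (by norm_num)
  have hdiff' : Differentiable ℝ (fderiv ℝ F) :=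
    (hF.fderiv_right (m := 1) (by norm_num)).differentiable (by norm_num)
  set B := fderiv ℝ (fderiv ℝ F) y with hB
  have hsymm : ∀ v w, B v w = B w v := fun v w =>
    second_derivative_symmetric (fun x => (hdiff x).hasFDerivAt) (hdiff' y).hasFDerivAt v w
  have ho := hasFDerivAt_iff_isLittleO_nhds_zero.1 (hdiff' y).hasFDerivAt
  obtain ⟨δ, hδ, hball⟩ := Metric.eventually_nhds_iff_ball.1 (ho.def hε)
  refine ⟨δ / 2, by positivity, fun w hw => ?_⟩
  let φ : W → ℝ := fun w => F (y + w) - fderiv ℝ F y w - B w w / 2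
  let φ' : W → W →L[ℝ] ℝ := fun w => fderiv ℝ F (y + w) - fderiv ℝ F y - B w
  have hφ : ∀ x, HasFDerivAt φ (φ' x) x := by
    intro x
    have h1 : HasFDerivAt (fun w => F (y + w)) (fderiv ℝ F (y + x)) x := by
      have := (hdiff (y + x)).hasFDerivAt.comp x ((hasFDerivAt_id x).const_add y)
      simpa using! this
    have h2 : HasFDerivAt (fun w => B w w) (B x + B x) x := by
      have := B.hasFDerivAt.clm_apply (hasFDerivAt_id x)
      refine this.congr_fderiv ?_
      ext v
      simp [hsymm v x]
    have h3 := (h1.sub (fderiv ℝ F y).hasFDerivAt).sub (h2.mul_const (1 / 2))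
    refine (h3.congr_of_eventuallyEq (Filter.Eventually.of_forall fun w => ?_)).congr_fderiv ?_
    · simp only [φ, Pi.sub_apply]
      ring
    · ext v
      simp [φ']
      ring
  have hbound : ∀ x ∈ Metric.closedBall (0 : W) ‖w‖, ‖φ' x‖ ≤ ε * ‖w‖ := by
    intro x hx
    rw [mem_closedBall_zero_iff] at hx
    have hxδ : x ∈ Metric.ball (0 : W) δ := mem_ball_zero_iff.2 (by linarith)
    exact (hball x hxδ).trans (mul_le_mul_of_nonneg_left hx hε.le)
  have := (convex_closedBall (0 : W) ‖w‖).norm_image_sub_le_of_norm_hasFDerivWithin_le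
    (fun x _ => (hφ x).hasFDerivWithinAt) hbound
    (Metric.mem_closedBall_self (norm_nonneg w)) (mem_closedBall_zero_iff.2 le_rfl)
  rw [Real.norm_eq_abs, sub_zero, mul_assoc, ← pow_two] at this
  convert this using 2
  simp [φ]
  ring

/-! ### Differentiation of means -/

variable {Γ : Type} [Group Γ] {T : Set Γ} {U W : Type} [NormedAddCommGroup U] [NormedSpace ℝ U]
  [NormedAddCommGroup W] [NormedSpace ℝ W]

theorem exists_mean_clm (hT : HasCommonPeriods T) (A : Γ → U →L[ℝ] ℝ) {c : ℝ}
    (hA : ∀ g, ‖A g‖ ≤ c) (hper : ∀ u, IsPeriodic T fun g => A g u) :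
    ∃ D : U →L[ℝ] ℝ, ∀ u, D u = mean T fun g => A g u := by
  let D : U →ₗ[ℝ] ℝ :=
    { toFun := fun u => mean T fun g => A g u
      map_add' := fun u v => by
        simp only [map_add]
        exact mean_add hT (hper u) (hper v)
      map_smul' := fun r u => by
        simp only [map_smul, smul_eq_mul, RingHom.id_apply]
        exact mean_const_mul hT r (hper u) }
  refine ⟨D.mkContinuous c fun u => abs_mean_le hT (hper u) fun g => ?_, fun u => rfl⟩
  exact (A g).le_of_opNorm_le (hA g) u

/-- A bounded family of operators `L g`, for which all `g ↦ L g u` are periodic. -/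
structure IsPeriodicFamily (T : Set Γ) (L : Γ → U →L[ℝ] W) (c : ℝ) : Prop where
  nonneg : 0 ≤ c
  norm_le : ∀ g, ‖L g‖ ≤ c
  periodic : ∀ u, IsPeriodic T fun g => L g u

theorem IsPeriodicFamily.norm_apply_le {L : Γ → U →L[ℝ] W} {c : ℝ} (hL : IsPeriodicFamily T L c)
    (g : Γ) (u : U) : ‖L g u‖ ≤ c * ‖u‖ := (L g).le_of_opNorm_le (hL.norm_le g) u

/-- If `φ` is `o(w)` at `0`, uniformly in a finite set of parameters, then so is its mean along
a periodic family. -/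
theorem mean_isLittleO (hT : HasCommonPeriods T) {L : Γ → U →L[ℝ] W} {c : ℝ}
    (hL : IsPeriodicFamily T L c) {X : Type} {p : Γ → X} (hp : IsPeriodic T p)
    {φ : X → W → ℝ} (hφ : ∀ x, φ x =o[𝓝 0] fun w => w) :
    (fun u => mean T fun g => φ (p g) (L g u)) =o[𝓝 0] fun u : U => u := by
  rw [Asymptotics.isLittleO_iff]
  intro ε hε
  have hc : 0 < c + 1 := by linarith [hL.nonneg]
  have h1 : ∀ᶠ w in 𝓝 (0 : W), ∀ x ∈ Set.range p, ‖φ x w‖ ≤ ε / (c + 1) * ‖w‖ :=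
    (Filter.eventually_all_finite (hp.finite_range hT)).2 fun x _ => (hφ x).def (by positivity)
  obtain ⟨δ, hδ, hball⟩ := Metric.eventually_nhds_iff_ball.1 h1
  filter_upwards [Metric.ball_mem_nhds (0 : U) (show 0 < δ / (c + 1) by positivity)] with u hu
  rw [mem_ball_zero_iff, lt_div_iff₀ hc] at hu
  refine abs_mean_le hT (hp.comp₂ hT (hL.periodic u) fun x w => φ x w) fun g => ?_
  have h2 := hL.norm_apply_le g u
  have h3 : L g u ∈ Metric.ball (0 : W) δ := by
    rw [mem_ball_zero_iff]
    nlinarith [norm_nonneg u]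
  calc |φ (p g) (L g u)| ≤ ε / (c + 1) * ‖L g u‖ := hball _ h3 _ ⟨g, rfl⟩
    _ ≤ ε / (c + 1) * ((c + 1) * ‖u‖) := by
      gcongr
      nlinarith [norm_nonneg u]
    _ = ε * ‖u‖ := by field_simp

/-- Differentiation passes under the mean because `‖L g u‖ ≤ c ‖u‖` makes the remainders uniform in
`g`. The first derivative is needed at every `w`, where the base points `y + L g w` take finitely
many values; the second only at `0`, where they all equal `y`. -/
theorem fderiv_fderiv_mean (hT : HasCommonPeriods T) {L : Γ → U →L[ℝ] W} {c : ℝ}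
    (hL : IsPeriodicFamily T L c) {F : W → ℝ} (hF : ContDiff ℝ 2 F) (y : W) {E : U → ℝ}
    (hE : ∀ u, E u = mean T fun g => F (y + L g u)) (u v : U) :
    fderiv ℝ (fderiv ℝ E) 0 u v =
      mean T fun g => fderiv ℝ (fderiv ℝ F) y (L g u) (L g v) := by
  have hdiff : Differentiable ℝ F := hF.differentiable (by norm_num)
  have hdiff' : Differentiable ℝ (fderiv ℝ F) :=
    (hF.fderiv_right (m := 1) (by norm_num)).differentiable (by norm_num)
  set B := fderiv ℝ (fderiv ℝ F) y with hB
  have hD : ∀ w : U, ∃ D : U →L[ℝ] ℝ, ∀ u, D u = mean T fun g => fderiv ℝ F (y + L g w) (L g u) := by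
    intro w
    -- Periodicity leaves finitely many derivatives `F'(y + L g w)`, hence a common bound `r`.
    obtain ⟨r, hr⟩ := (((hL.periodic w).comp fun x => ‖fderiv ℝ F (y + x)‖).finite_range hT).bddAbove
    refine exists_mean_clm hT (fun g => (fderiv ℝ F (y + L g w)).comp (L g)) (c := r * c)
      (fun g => ?_) fun u => (hL.periodic w).comp₂ hT (hL.periodic u) fun a b => fderiv ℝ F (y + a) b
    exact (ContinuousLinearMap.opNorm_comp_le _ _).trans
      (mul_le_mul (hr ⟨g, rfl⟩) (hL.norm_le g) (norm_nonneg _)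
        ((norm_nonneg _).trans (hr ⟨g, rfl⟩)))
  choose D hD using hD
  have hED : ∀ w, HasFDerivAt E (D w) w := by
    intro w
    rw [hasFDerivAt_iff_isLittleO_nhds_zero]
    have := mean_isLittleO hT hL (hL.periodic w)
      (φ := fun x k => F (y + x + k) - F (y + x) - fderiv ℝ F (y + x) k)
      fun x => hasFDerivAt_iff_isLittleO_nhds_zero.1 (hdiff (y + x)).hasFDerivAt
    refine this.congr_left fun k => ?_
    have p1 := (hL.periodic w).comp₂ hT (hL.periodic k) fun a b => F (y + a + b)
    have p2 := (hL.periodic w).comp fun a => F (y + a)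
    have p3 := (hL.periodic w).comp₂ hT (hL.periodic k) fun a b => fderiv ℝ F (y + a) b
    rw [mean_sub hT ((hL.periodic w).comp₂ hT (hL.periodic k) fun a b => F (y + a + b) - F (y + a))
      p3, mean_sub hT p1 p2, hE, hE, hD]
    simp only [map_add, add_assoc]
  have hperB : ∀ u v, IsPeriodic T fun g => B (L g u) (L g v) := fun u v =>
    (hL.periodic u).comp₂ hT (hL.periodic v) fun a b => B a b
  let H : U →L[ℝ] U →L[ℝ] ℝ := LinearMap.mkContinuous₂
    (LinearMap.mk₂ ℝ (fun u v => mean T fun g => B (L g u) (L g v))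
      (fun u u' v => by
        simp only [map_add, add_apply]
        exact mean_add hT (hperB u v) (hperB u' v))
      (fun r u v => by
        simp only [map_smul, smul_apply, smul_eq_mul]
        exact mean_const_mul hT r (hperB u v))
      (fun u v v' => by
        simp only [map_add]
        exact mean_add hT (hperB u v) (hperB u v'))
      (fun r u v => by
        simp only [map_smul, smul_eq_mul]
        exact mean_const_mul hT r (hperB u v)))
    (‖B‖ * c * c) (fun u v => by
      refine abs_mean_le hT (hperB u v) fun g => ?_
      refine (B.le_opNorm₂ _ _).trans ?_
      have h0 := hL.nonneg
      have h1 := hL.norm_apply_le g u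
      have h2 := hL.norm_apply_le g v
      calc ‖B‖ * ‖L g u‖ * ‖L g v‖ ≤ ‖B‖ * (c * ‖u‖) * (c * ‖v‖) := by gcongr
        _ = ‖B‖ * c * c * ‖u‖ * ‖v‖ := by ring)
  have hH : ∀ u v, H u v = mean T fun g => B (L g u) (L g v) := fun u v => rfl
  have hDH : HasFDerivAt D H 0 := by
    rw [hasFDerivAt_iff_isLittleO_nhds_zero]
    have h1 := mean_isLittleO hT hL (hL.periodic 0)
      (φ := fun _ k => ‖fderiv ℝ F (y + k) - fderiv ℝ F y - B k‖)
      fun _ => (hasFDerivAt_iff_isLittleO_nhds_zero.1 (hdiff' y).hasFDerivAt).norm_left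
    refine (Asymptotics.IsBigO.of_bound c (Filter.Eventually.of_forall fun k => ?_)).trans_isLittleO h1
    have p1 := (hL.periodic k).comp fun k => ‖fderiv ℝ F (y + k) - fderiv ℝ F y - B k‖
    have hm : 0 ≤ mean T fun g => ‖fderiv ℝ F (y + L g k) - fderiv ℝ F y - B (L g k)‖ :=
      mean_nonneg hT p1 fun g => norm_nonneg _
    rw [Real.norm_of_nonneg hm]
    refine ContinuousLinearMap.opNorm_le_bound _ (mul_nonneg hL.nonneg hm) fun v => ?_
    have p2 := (hL.periodic k).comp₂ hT (hL.periodic v) fun a b => fderiv ℝ F (y + a) b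
    have p3 := (hL.periodic v).comp fun b => fderiv ℝ F y b
    have hval : (D (0 + k) - D 0 - H k) v =
        mean T fun g => (fderiv ℝ F (y + L g k) - fderiv ℝ F y - B (L g k)) (L g v) := by
      simp only [sub_apply, hD, hH, zero_add, map_zero, add_zero]
      rw [mean_sub hT ((hL.periodic k).comp₂ hT (hL.periodic v)
        fun a b => fderiv ℝ F (y + a) b - fderiv ℝ F y b) (hperB k v), mean_sub hT p2 p3]
    have p4 := (hL.periodic k).comp₂ hT (hL.periodic v)
      fun a b => (fderiv ℝ F (y + a) - fderiv ℝ F y - B a) b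
    have hle : ∀ g, |(fderiv ℝ F (y + L g k) - fderiv ℝ F y - B (L g k)) (L g v)| ≤
        c * ‖v‖ * ‖fderiv ℝ F (y + L g k) - fderiv ℝ F y - B (L g k)‖ := by
      intro g
      rw [← Real.norm_eq_abs, mul_comm]
      exact ContinuousLinearMap.le_opNorm_of_le _ (hL.norm_apply_le g v)
    have hmul := mean_const_mul hT (c * ‖v‖) p1
    rw [hval, Real.norm_eq_abs, mul_right_comm, ← hmul, abs_le]
    constructor
    · have := mean_mono hT (p1.comp fun x => -1 * (c * ‖v‖ * x)) p4 fun g => by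
        have := (abs_le.1 (hle g)).1
        linarith
      rw [mean_const_mul hT _ (p1.comp fun x => c * ‖v‖ * x)] at this
      linarith
    · exact mean_mono hT p4 (p1.comp fun x => c * ‖v‖ * x) fun g => (abs_le.1 (hle g)).2
  rw [funext fun w => (hED w).fderiv, hDH.fderiv, hH]

/-- Criterion for minimality: if the first variation vanishes, the second variation is bounded
below by `a * q`, `a > 0`, and `q` controls the mean of `‖L g u‖²`, then `E u ≥ E 0` for small `u`
with this control. -/
theorem exists_forall_le_of_coercive (hT : HasCommonPeriods T) {L : Γ → U →L[ℝ] W} {c : ℝ}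
    (hL : IsPeriodicFamily T L c) {F : W → ℝ} (hF : ContDiff ℝ 2 F) (y : W) {E : U → ℝ}
    (hE : ∀ u, E u = mean T fun g => F (y + L g u))
    (hfirst : ∀ u, mean T (fun g => fderiv ℝ F y (L g u)) = 0) {a : ℝ} (ha : 0 < a) {q : U → ℝ}
    (hq : ∀ u, a * q u ≤ fderiv ℝ (fderiv ℝ E) 0 u u) {K : ℝ} (hK : 0 < K) :
    ∃ δ > 0, ∀ u, ‖u‖ ≤ δ → mean T (fun g => ‖L g u‖ ^ 2) ≤ K * q u → E 0 ≤ E u := by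
  -- With this tolerance the Taylor error is at most `a * q u / 2` in mean, exactly what half the
  -- second variation provides.
  obtain ⟨δ, hδ, htaylor⟩ := exists_taylor_two hF y (show 0 < a / (2 * K) by positivity)
  have hc : 0 < c + 1 := by linarith [hL.nonneg]
  refine ⟨δ / (c + 1), by positivity, fun u hu hqu => ?_⟩
  rw [le_div_iff₀ hc] at hu
  set B := fderiv ℝ (fderiv ℝ F) y with hB
  have p0 : IsPeriodic T fun _ : Γ => F y := (hL.periodic u).comp fun _ => F y
  have p1 := (hL.periodic u).comp fun x => fderiv ℝ F y x
  have p2 := (hL.periodic u).comp fun x => B x x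
  have p3 := (hL.periodic u).comp fun x => ‖x‖ ^ 2
  have hlow : ∀ g, F y + fderiv ℝ F y (L g u) + 1 / 2 * B (L g u) (L g u) ≤
      F (y + L g u) + a / (2 * K) * ‖L g u‖ ^ 2 := by
    intro g
    have h1 : ‖L g u‖ ≤ δ := by
      have := hL.norm_apply_le g u
      nlinarith [norm_nonneg u]
    have := (abs_le.1 (htaylor (L g u) h1)).1
    linarith
  have hmean := mean_mono hT
    ((hL.periodic u).comp fun x => F y + fderiv ℝ F y x + 1 / 2 * B x x)
    ((hL.periodic u).comp fun x => F (y + x) + a / (2 * K) * ‖x‖ ^ 2) hlow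
  rw [mean_add hT ((hL.periodic u).comp fun x => F y + fderiv ℝ F y x)
    (p2.comp fun x => 1 / 2 * x), mean_add hT p0 p1, mean_const_mul hT _ p2,
    mean_add hT ((hL.periodic u).comp fun x => F (y + x)) (p3.comp fun x => a / (2 * K) * x),
    mean_const_mul hT _ p3, ← hE, hfirst, ← fderiv_fderiv_mean hT hL hF y hE u u] at hmean
  have hE0 : E 0 = mean T fun _ => F y := by
    rw [hE]
    simp only [map_zero, add_zero]
  have h2 := mul_le_mul_of_nonneg_left hqu (show 0 ≤ a / (2 * K) by positivity)
  have h3 : a / (2 * K) * (K * q u) = a * q u / 2 := by field_simp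
  have := hq u
  rw [hE0]
  linarith

end Analysis

end ObjStruct

/-! ### The energy as a mean of a potential on a finite-dimensional space -/

namespace ObjStruct

section Reduction

variable {d₁ d₂ : ℕ} {G : Subgroup (Euc (Fin d₁ ⊕ Fin d₂))}

/-- The `ℝ^d`-valued functions on a finite interaction range. -/
abbrev RangeConfig (RV : Finset {g : G // g ≠ 1}) : Type := RV → Vec (Fin d₁ ⊕ Fin d₂)

/-- Restriction to the interaction range. -/
def restrictRange (RV : Finset {g : G // g ≠ 1}) (y : Config G) : RangeConfig RV := fun h => y h

open Classical in
/-- Extension by zero. -/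
noncomputable def extendRange (RV : Finset {g : G // g ≠ 1}) :
    RangeConfig RV →L[ℝ] Bdd {g : G // g ≠ 1} (Vec (Fin d₁ ⊕ Fin d₂)) :=
  ∑ h : RV, (lp.singleContinuousLinearMap ℝ _ ∞ h.1).comp (ContinuousLinearMap.proj h)

theorem extendRange_apply {RV : Finset {g : G // g ≠ 1}} (y : Config G) (g : {g : G // g ≠ 1}) :
    extendRange RV (restrictRange RV y) g = (RV : Set {g : G // g ≠ 1}).indicator y g := by
  classical
  have h1 : extendRange RV (restrictRange RV y) g =
      ∑ h : RV, (Pi.single h.1 (y h.1) : Config G) g := by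
    simp only [extendRange, sum_apply, lp.coeFn_sum, Finset.sum_apply]
    rfl
  rw [h1, Finset.sum_coe_sort RV fun h => (Pi.single h (y h) : Config G) g, Set.indicator_apply]
  simp only [Pi.single_apply, Finset.sum_ite_eq, Finset.mem_coe]

/-- The potential as a function of the configuration on the interaction range. -/
noncomputable def rangePotential (V : Config G → ℝ) (RV : Finset {g : G // g ≠ 1})
    (w : RangeConfig RV) : ℝ :=
  V fun g => (0 : Config G) g + extendRange RV w g

theorem contDiff_rangePotential {V : Config G → ℝ} (hV : SmoothPotential V)
    (RV : Finset {g : G // g ≠ 1}) : ContDiff ℝ 2 (rangePotential V RV) :=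
  (hV 0).comp (extendRange RV).contDiff

theorem rangePotential_restrict {V : Config G → ℝ} {RV : Finset {g : G // g ≠ 1}}
    (hRV : IsInteractionRange V RV) (y : Config G) :
    V y = rangePotential V RV (restrictRange RV y) := by
  rw [hRV y, rangePotential]
  congr 1
  ext1 g
  rw [extendRange_apply, Pi.zero_apply, zero_add]

theorem norm_rot {ι : Type} [Fintype ι] (g : Euc ι) (x : Vec ι) : ‖rot g x‖ = ‖x‖ :=
  (rot g).norm_map x

/-- The relative displacement `(rot(h) u(gh) - u(g))_{h ∈ RV}` as a function of `u`. -/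
noncomputable def relDisp (T : Set G) (RV : Finset {g : G // g ≠ 1}) (g : G) :
    Uper T (Vec (Fin d₁ ⊕ Fin d₂)) →L[ℝ] RangeConfig RV :=
  (ContinuousLinearMap.pi fun h : RV =>
    (rot (h.1.1 : Euc (Fin d₁ ⊕ Fin d₂))).toLinearIsometry.toContinuousLinearMap.comp
      (lp.evalCLM ℝ (fun _ : G => Vec (Fin d₁ ⊕ Fin d₂)) ∞ (g * h.1.1)) -
        lp.evalCLM ℝ (fun _ : G => Vec (Fin d₁ ⊕ Fin d₂)) ∞ g).comp (Submodule.subtypeL _)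

theorem relDisp_apply (T : Set G) (RV : Finset {g : G // g ≠ 1}) (g : G)
    (u : Uper T (Vec (Fin d₁ ⊕ Fin d₂))) (h : RV) :
    relDisp T RV g u h = rot (h.1.1 : Euc (Fin d₁ ⊕ Fin d₂)) (u.1 (g * h.1.1)) - u.1 g := rfl

theorem norm_apply_le_norm (T : Set G) (u : Uper T (Vec (Fin d₁ ⊕ Fin d₂))) (g : G) :
    ‖u.1 g‖ ≤ ‖u‖ :=
  lp.norm_apply_le_norm (by simp) u.1 g

theorem PeriodicWith.relDisp {T : Set G} {N : ℕ} (hN : Admissible T N)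
    {u : Uper T (Vec (Fin d₁ ⊕ Fin d₂))} (hu : PeriodicWith T N fun g => u.1 g)
    (RV : Finset {g : G // g ≠ 1}) : PeriodicWith T N fun g => relDisp T RV g u := by
  intro g t ht
  ext1 h
  have h1 := hu.mul_right hN h.1.1 g t ht
  have h2 := hu g t ht
  simp only at h1 h2 ⊢
  rw [relDisp_apply, relDisp_apply, h1, h2]

theorem isPeriodicFamily_relDisp {T : Set G} (hT : HasCommonPeriods T)
    (hne : ∃ N, Admissible T N) (RV : Finset {g : G // g ≠ 1}) :
    IsPeriodicFamily T (relDisp T RV) 2 where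
  nonneg := zero_le_two
  norm_le g := by
    refine ContinuousLinearMap.opNorm_le_bound _ zero_le_two fun u => ?_
    refine (pi_norm_le_iff_of_nonneg (by positivity)).2 fun h => ?_
    rw [relDisp_apply, two_mul]
    refine (norm_sub_le _ _).trans (add_le_add ?_ (norm_apply_le_norm T u g))
    rw [norm_rot]
    exact norm_apply_le_norm T u _
  periodic u := by
    obtain ⟨N, hN, hu⟩ := isPeriodic_of_mem_Uper hT hne u.2
    exact ⟨N, hN, hu.relDisp hN RV⟩

theorem coe_mul_apply (g h : G) (x : Vec (Fin d₁ ⊕ Fin d₂)) :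
    ((g * h : G) : Euc (Fin d₁ ⊕ Fin d₂)) x =
      (g : Euc (Fin d₁ ⊕ Fin d₂)) ((h : Euc (Fin d₁ ⊕ Fin d₂)) x) := rfl

/-- Factor `rot(g)` out of the difference and discard it by invariance of `V`; then use `h · (x₀ +
x) = h · x₀ + rot(h) x`. -/
theorem potential_displaced {V : Config G → ℝ} (hV : OrthInvariant V)
    {RV : Finset {g : G // g ≠ 1}} (hRV : IsInteractionRange V RV) (T : Set G)
    (x₀ : Vec (Fin d₁ ⊕ Fin d₂)) (u : Uper T (Vec (Fin d₁ ⊕ Fin d₂))) (g : G) :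
    V (fun h => ((g * h.1 : G) : Euc (Fin d₁ ⊕ Fin d₂)) (x₀ + u.1 (g * h.1)) -
      (g : Euc (Fin d₁ ⊕ Fin d₂)) (x₀ + u.1 g)) =
      rangePotential V RV ((restrictRange RV (refConfig G x₀)) + relDisp T RV g u) := by
  rw [← hV (rot (g : Euc (Fin d₁ ⊕ Fin d₂)) : Orth _).symm, rangePotential_restrict hRV]
  congr 1
  ext1 h
  have h1 : ∀ x y : Vec (Fin d₁ ⊕ Fin d₂), (rot (g : Euc (Fin d₁ ⊕ Fin d₂))).symm
      (((g * h.1.1 : G) : Euc (Fin d₁ ⊕ Fin d₂)) (x₀ + x) -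
        (g : Euc (Fin d₁ ⊕ Fin d₂)) (x₀ + y)) =
      (h.1.1 : Euc (Fin d₁ ⊕ Fin d₂)) x₀ - x₀ + (rot (h.1.1 : Euc (Fin d₁ ⊕ Fin d₂)) x - y) := by
    intro x y
    rw [coe_mul_apply, euc_sub, LinearIsometryEquiv.symm_apply_apply, euc_add]
    abel
  exact h1 _ _

theorem displacedEnergy_eq_mean {T : Set G} (hT : HasCommonPeriods T)
    (hne : ∃ N, Admissible T N) {V : Config G → ℝ} (hV : OrthInvariant V)
    {RV : Finset {g : G // g ≠ 1}} (hRV : IsInteractionRange V RV) (x₀ : Vec (Fin d₁ ⊕ Fin d₂))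
    (u : Uper T (Vec (Fin d₁ ⊕ Fin d₂))) :
    displacedEnergy T V x₀ u =
      mean T fun g => rangePotential V RV ((restrictRange RV (refConfig G x₀)) + relDisp T RV g u) := by
  rw [displacedEnergy, energy]
  simp only [potential_displaced hV hRV]
  refine cellMean_period_eq_mean hT ((isPeriodic_of_mem_Uper hT hne u.2).comp (x₀ + ·)) ?_
  intro N hN hu
  have hu' : PeriodicWith T N fun g => u.1 g := fun g t ht => add_left_cancel (hu g t ht)
  exact (hu'.relDisp hN RV).comp
    fun w => rangePotential V RV ((restrictRange RV (refConfig G x₀)) + w)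

/-! ### The first variation -/

theorem vec_eq_sum {ι : Type} [Fintype ι] [DecidableEq ι] (a : Vec ι) :
    a = ∑ j, a j • EuclideanSpace.single j (1 : ℝ) := by
  simpa using ((EuclideanSpace.basisFun ι ℝ).sum_repr a).symm

theorem rotMatrix_mulVec {ι : Type} [Fintype ι] [DecidableEq ι] (g : Euc ι) (a : Vec ι) :
    (rotMatrix g).mulVec a.ofLp = (rot g a).ofLp := by
  ext i
  conv_rhs => rw [vec_eq_sum a, map_sum]
  simp [Matrix.mulVec, dotProduct, rotMatrix, mul_comm]

open Classical in
theorem partialV_eq {V : Config G → ℝ} {RV : Finset {g : G // g ≠ 1}}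
    (hV : SmoothPotential V) (hRV : IsInteractionRange V RV) (y : Config G)
    (g : {g : G // g ≠ 1}) (a : Vec (Fin d₁ ⊕ Fin d₂)) :
    partialV V y g ⬝ᵥ a.ofLp = fderiv ℝ (rangePotential V RV) (restrictRange RV y)
      (restrictRange RV (Pi.single g a)) := by
  let ρ : Bdd {g : G // g ≠ 1} (Vec (Fin d₁ ⊕ Fin d₂)) →L[ℝ] RangeConfig RV :=
    ContinuousLinearMap.pi fun h => lp.evalCLM ℝ _ ∞ h.1
  have hd : HasFDerivAt
      (fun z : Bdd {g : G // g ≠ 1} (Vec (Fin d₁ ⊕ Fin d₂)) => V fun g => y g + z g)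
      ((fderiv ℝ (rangePotential V RV) (restrictRange RV y)).comp ρ) 0 := by
    have h1 : (fun z : Bdd {g : G // g ≠ 1} (Vec (Fin d₁ ⊕ Fin d₂)) => V fun g => y g + z g) =
        fun z => rangePotential V RV (restrictRange RV y + ρ z) := by
      ext1 z
      rw [rangePotential_restrict hRV]
      rfl
    rw [h1]
    have h2 : HasFDerivAt (rangePotential V RV) (fderiv ℝ (rangePotential V RV) (restrictRange RV y))
        (restrictRange RV y + ρ 0) := by
      rw [map_zero, add_zero]
      exact ((contDiff_rangePotential hV RV).differentiable (by norm_num) _).hasFDerivAt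
    exact h2.comp 0 (ρ.hasFDerivAt.const_add _)
  have h3 : ∀ i, partialV V y g i =
      (fderiv ℝ (rangePotential V RV) (restrictRange RV y))
        (ρ (lp.single ∞ g (EuclideanSpace.single i (1 : ℝ)))) := by
    intro i
    rw [partialV, hd.fderiv]
    rfl
  have h4 : restrictRange RV (Pi.single g a) =
      ∑ i, a i • ρ (lp.single ∞ g (EuclideanSpace.single i (1 : ℝ))) := by
    have h5 : lp.single ∞ g a = ∑ i, a i •
        lp.single (E := fun _ : {g : G // g ≠ 1} => Vec (Fin d₁ ⊕ Fin d₂)) ∞ g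
          (EuclideanSpace.single i (1 : ℝ)) := by
      conv_lhs => rw [vec_eq_sum a]
      have := map_sum (lp.lsingle (𝕜 := ℝ)
        (E := fun _ : {g : G // g ≠ 1} => Vec (Fin d₁ ⊕ Fin d₂)) ∞ g)
        (fun j => a j • EuclideanSpace.single j (1 : ℝ)) Finset.univ
      simp only [map_smul] at this
      exact this
    simp only [← map_smul, ← map_sum]
    rw [← h5]
    rfl
  rw [h4, map_sum, dotProduct]
  exact Finset.sum_congr rfl fun i _ => by rw [h3, map_smul, smul_eq_mul, mul_comm]

/-- The left-hand side is the number `e_V · a`. -/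
theorem fderiv_rangePotential_rot_sub {V : Config G → ℝ} {RV : Finset {g : G // g ≠ 1}}
    (hV : SmoothPotential V) (hRV : IsInteractionRange V RV) {x₀ : Vec (Fin d₁ ⊕ Fin d₂)}
    (heV : eVec V x₀ = 0) (a : Vec (Fin d₁ ⊕ Fin d₂)) :
    fderiv ℝ (rangePotential V RV) (restrictRange RV (refConfig G x₀))
      (fun h : RV => rot (h.1.1 : Euc (Fin d₁ ⊕ Fin d₂)) a - a) = 0 := by
  classical
  -- Outside the range the partial derivatives vanish, so the series defining `e_V` is a finite sum.
  have hzero : ∀ g ∉ RV, partialV V (refConfig G x₀) g = 0 := by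
    intro g hg
    ext i
    have := partialV_eq hV hRV (refConfig G x₀) g (EuclideanSpace.single i (1 : ℝ))
    have h0 : restrictRange RV (Pi.single g (EuclideanSpace.single i (1 : ℝ))) = 0 := by
      ext1 h
      exact Pi.single_eq_of_ne (fun h1 : h.1 = g => hg (h1 ▸ h.2)) _
    rw [h0, map_zero] at this
    simpa using this
  rw [eVec, tsum_eq_sum (s := RV) fun g hg => by rw [hzero g hg, Matrix.zero_vecMul]] at heV
  have h1 := congrArg (· ⬝ᵥ a.ofLp) heV
  simp only [sum_dotProduct, zero_dotProduct, ← Matrix.dotProduct_mulVec, Matrix.sub_mulVec,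
    Matrix.one_mulVec, rotMatrix_mulVec, ← WithLp.ofLp_sub, partialV_eq hV hRV] at h1
  rw [← h1, ← map_sum]
  congr 1
  ext1 h
  rw [Finset.sum_apply]
  simp only [restrictRange, Pi.single_apply, Finset.sum_ite_eq, h.2, if_true]

theorem mean_first_variation {T : Set G} (hT : HasCommonPeriods T)
    (hne : ∃ N, Admissible T N) {V : Config G → ℝ} {RV : Finset {g : G // g ≠ 1}}
    (hV : SmoothPotential V) (hRV : IsInteractionRange V RV) {x₀ : Vec (Fin d₁ ⊕ Fin d₂)}
    (heV : eVec V x₀ = 0) (u : Uper T (Vec (Fin d₁ ⊕ Fin d₂))) :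
    mean T (fun g => fderiv ℝ (rangePotential V RV) (restrictRange RV (refConfig G x₀))
      (relDisp T RV g u)) = 0 := by
  classical
  set D := fderiv ℝ (rangePotential V RV) <| restrictRange RV (refConfig G x₀)
  have hu := isPeriodic_of_mem_Uper hT hne u.2
  have hD : ∀ w : RangeConfig RV, D w = ∑ h, D (Pi.single h (w h)) := by
    intro w
    rw [← map_sum, Finset.univ_sum_single]
  have p : ∀ h : RV, IsPeriodic T fun g =>
      D (Pi.single h (rot (h.1.1 : Euc (Fin d₁ ⊕ Fin d₂)) (u.1 g))) :=
    fun h => hu.comp fun x => D (Pi.single h (rot (h.1.1 : Euc (Fin d₁ ⊕ Fin d₂)) x))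
  have p' : ∀ h : RV, IsPeriodic T fun g => D (Pi.single h (u.1 g)) :=
    fun h => hu.comp fun x => D (Pi.single h x)
  -- In each component `h`, right invariance of the mean replaces `u(gh)` by `u(g)`. Afterwards the
  -- integrand is `e_V · u(g)`, which is zero pointwise.
  have h1 : ∀ h : RV, mean T (fun g => D (Pi.single h (relDisp T RV g u h))) =
      mean T fun g => D (Pi.single h (rot (h.1.1 : Euc (Fin d₁ ⊕ Fin d₂)) (u.1 g) - u.1 g)) := by
    intro h
    simp only [relDisp_apply, Pi.single_sub, map_sub]
    rw [mean_sub hT ((p h).mul_right h.1.1) (p' h), mean_sub hT (p h) (p' h)]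
    congr 1
    exact mean_comp_mul_right hT (p h) h.1.1
  simp only [hD (relDisp T RV _ u)]
  rw [mean_sum hT hu Finset.univ fun h N hN hp => (hp.relDisp hN RV).comp
      fun w => D (Pi.single h (w h)), Finset.sum_congr rfl fun h _ => h1 h,
    ← mean_sum hT hu Finset.univ fun h N hN hp => hp.comp
      fun x => D (Pi.single h (rot (h.1.1 : Euc (Fin d₁ ⊕ Fin d₂)) x - x))]
  have h2 : ∀ g, ∑ h, D (Pi.single h (rot (h.1.1 : Euc (Fin d₁ ⊕ Fin d₂)) (u.1 g) - u.1 g)) = 0 :=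
    fun g => by
      rw [← hD fun h => rot (h.1.1 : Euc (Fin d₁ ⊕ Fin d₂)) (u.1 g) - u.1 g]
      exact fderiv_rangePotential_rot_sub hV hRV heV (u.1 g)
  simp only [h2]
  have := mean_const_mul hT 0 (hu.comp fun _ => (0 : ℝ))
  simpa using this

/-! ### The seminorm and the conditional minimality criterion -/

/-- The mean over a cell of the squared local deviation from infinitesimal isometries. -/
noncomputable def meanDeviation (T : Set G) (x₀ : Vec (Fin d₁ ⊕ Fin d₂)) (R : Finset G)
    (u : G → Vec (Fin d₁ ⊕ Fin d₂)) : ℝ :=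
  mean T fun g => ‖(UisoZZ x₀ R)ᗮ.starProjection (localDisp u R g)‖ ^ 2

theorem PeriodicWith.localDisp {T : Set G} {N : ℕ} (hN : Admissible T N)
    {u : G → Vec (Fin d₁ ⊕ Fin d₂)} (hu : PeriodicWith T N u) (R : Finset G) :
    PeriodicWith T N fun g => localDisp u R g := by
  intro g t ht
  refine congrArg (WithLp.toLp 2) (funext fun h => ?_)
  exact hu.mul_right hN h.1 g t ht

theorem IsPeriodic.localDisp {T : Set G} {u : G → Vec (Fin d₁ ⊕ Fin d₂)} (hu : IsPeriodic T u)
    (R : Finset G) : IsPeriodic T fun g => localDisp u R g :=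
  let ⟨N, hN, hu⟩ := hu
  ⟨N, hN, hu.localDisp hN R⟩

theorem meanDeviation_nonneg {T : Set G} (hT : HasCommonPeriods T) (x₀ : Vec (Fin d₁ ⊕ Fin d₂))
    (R : Finset G) {u : G → Vec (Fin d₁ ⊕ Fin d₂)} (hu : IsPeriodic T u) :
    0 ≤ meanDeviation T x₀ R u :=
  mean_nonneg hT ((hu.localDisp R).comp fun v => ‖(UisoZZ x₀ R)ᗮ.starProjection v‖ ^ 2)
    fun _ => by positivity

theorem seminormZZ_sq {T : Set G} (hT : HasCommonPeriods T) (x₀ : Vec (Fin d₁ ⊕ Fin d₂))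
    (R : Finset G) {u : G → Vec (Fin d₁ ⊕ Fin d₂)} (hu : IsPeriodic T u) :
    seminormZZ T x₀ R u ^ 2 = meanDeviation T x₀ R u := by
  have h : cellMean (powGroup T (period T u)) (fun g =>
      ‖(UisoZZ x₀ R)ᗮ.starProjection (localDisp u R g)‖ ^ 2) = meanDeviation T x₀ R u :=
    cellMean_period_eq_mean hT hu fun N hN hp =>
      (hp.localDisp hN R).comp fun v => ‖(UisoZZ x₀ R)ᗮ.starProjection v‖ ^ 2
  rw [seminormZZ, h, Real.sq_sqrt (meanDeviation_nonneg hT x₀ R hu)]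

theorem exists_forall_displacedEnergy_le {T : Set G} (hT : HasCommonPeriods T)
    (hne : ∃ N, Admissible T N) {V : Config G → ℝ} (hV_inv : OrthInvariant V)
    (hV : SmoothPotential V) {RV : Finset {g : G // g ≠ 1}} (hRV : IsInteractionRange V RV)
    {x₀ : Vec (Fin d₁ ⊕ Fin d₂)} (heV : eVec V x₀ = 0) {R : Finset G}
    (hstable : 0 < stabilityConstant T V x₀ R) {K : ℝ} (hK : 0 < K) :
    ∃ δ > 0, ∀ u : Uper T (Vec (Fin d₁ ⊕ Fin d₂)), ‖u‖ ≤ δ →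
      mean T (fun g => ‖relDisp T RV g u‖ ^ 2) ≤ K * meanDeviation T x₀ R (fun g => u.1 g) →
      displacedEnergy T V x₀ 0 ≤ displacedEnergy T V x₀ u := by
  obtain ⟨_, ⟨a, ha, rfl⟩, ha0⟩ := lt_sSup_iff.1 hstable
  refine exists_forall_le_of_coercive hT (isPeriodicFamily_relDisp hT hne RV)
    (contDiff_rangePotential hV RV) (restrictRange RV (refConfig G x₀))
    (displacedEnergy_eq_mean hT hne hV_inv hRV x₀) (mean_first_variation hT hne hV hRV heV)
    (EReal.coe_pos.1 ha0) (q := fun u => meanDeviation T x₀ R fun g => u.1 g) (fun u => ?_) hK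
  rw [← seminormZZ_sq hT x₀ R (isPeriodic_of_mem_Uper hT hne u.2)]
  exact ha u

end Reduction

end ObjStruct

/-! ### Control of the relative displacements: the case `d₁ ≤ 1` -/

namespace ObjStruct

section NoRotations

variable {d₁ d₂ : ℕ} {G : Subgroup (Euc (Fin d₁ ⊕ Fin d₂))}

theorem PropertyTwo.one_mem {x₀ : Vec (Fin d₁ ⊕ Fin d₂)} {R : Finset G} (hR : PropertyTwo x₀ R) :
    1 ∈ R := by
  obtain ⟨R', R'', h1, -, ⟨-, h2, -⟩, h3⟩ := hR
  exact h3 ⟨1, h1, 1, h2, mul_one 1⟩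

theorem PropertyTwo.closure_eq_top {x₀ : Vec (Fin d₁ ⊕ Fin d₂)} {R : Finset G}
    (hR : PropertyTwo x₀ R) : Subgroup.closure (R : Set G) = ⊤ := by
  obtain ⟨R', R'', -, h1, ⟨-, h2, -⟩, h3⟩ := hR
  refine top_le_iff.1 (h1 ▸ Subgroup.closure_mono fun g hg => h3 ⟨g, hg, 1, h2, mul_one g⟩)

theorem eq_zero_of_mem_skewZZ (hd : d₁ ≤ 1) {S : Matrix (Fin d₁ ⊕ Fin d₂) (Fin d₁ ⊕ Fin d₂) ℝ}
    (hS : S ∈ skewZZ d₁ d₂) : S = 0 := by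
  have : Subsingleton (Fin d₁) := Fin.subsingleton_iff_le_one.2 hd
  obtain ⟨h1, h2, h3⟩ := hS
  have h1' : ∀ i j, S j i = -S i j := fun i j => congrFun (congrFun h1 i) j
  have h2' : ∀ i j, S (Sum.inl i) (Sum.inr j) = 0 := fun i j => congrFun (congrFun h2 i) j
  have h3' : ∀ i j, S (Sum.inr i) (Sum.inr j) = 0 := fun i j => congrFun (congrFun h3 i) j
  ext (i | i) (j | j)
  · obtain rfl := Subsingleton.elim i j
    have := h1' (Sum.inl i) (Sum.inl i)
    simp only [Matrix.zero_apply]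
    linarith
  · exact h2' i j
  · rw [h1' (Sum.inl j) (Sum.inr i), h2', neg_zero, Matrix.zero_apply]
  · exact h3' i j

theorem UisoZZ_eq_Utrans (hd : d₁ ≤ 1) (x₀ : Vec (Fin d₁ ⊕ Fin d₂)) (R : Finset G) :
    UisoZZ x₀ R = Utrans R := by
  refine sup_eq_left.2 ?_
  rintro u ⟨S, hS, hu⟩
  refine ⟨0, fun g => ?_⟩
  rw [hu, eq_zero_of_mem_skewZZ hd hS, map_zero, LinearMap.zero_apply]

/-- Subtracting the projection `p` leaves an element of `Utrans R`, for which the left-hand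
expression vanishes. So only two components of `p` contribute, each at most `‖p‖`. -/
theorem norm_rot_sub_le_of_le_one (hd : d₁ ≤ 1) (x₀ : Vec (Fin d₁ ⊕ Fin d₂)) {R : Finset G}
    (h1 : 1 ∈ R) (v : LocalDisp R) (h : R) :
    ‖rot (h.1 : Euc (Fin d₁ ⊕ Fin d₂)) (v h) - v ⟨1, h1⟩‖ ≤
      2 * ‖(UisoZZ x₀ R)ᗮ.starProjection v‖ := by
  set p := (UisoZZ x₀ R)ᗮ.starProjection v
  have hmem : v - p ∈ Utrans R := by
    have hv : v - p = (UisoZZ x₀ R).starProjection v :=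
      sub_eq_of_eq_add (Submodule.starProjection_add_starProjection_orthogonal v).symm
    rw [← UisoZZ_eq_Utrans hd x₀ R, hv]
    exact Submodule.starProjection_apply_mem _ _
  obtain ⟨a, ha⟩ := hmem
  have h2 := (ha h).trans (ha ⟨1, h1⟩).symm
  have h3 : rot (h.1 : Euc (Fin d₁ ⊕ Fin d₂)) (v h) - v ⟨1, h1⟩ =
      rot (h.1 : Euc (Fin d₁ ⊕ Fin d₂)) (p h) - p ⟨1, h1⟩ := by
    rw [PiLp.sub_apply, PiLp.sub_apply, map_sub, map_sub] at h2
    have h4 : ∀ x : Vec (Fin d₁ ⊕ Fin d₂), rot ((1 : G) : Euc (Fin d₁ ⊕ Fin d₂)) x = x :=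
      fun _ => rfl
    rw [h4, h4] at h2
    rw [sub_eq_sub_iff_sub_eq_sub]
    exact h2
  rw [h3, two_mul]
  refine (norm_sub_le _ _).trans (add_le_add ?_ (PiLp.norm_apply_le p _))
  rw [norm_rot]
  exact PiLp.norm_apply_le p h

/-- The elements `h` for which the mean of `‖rot(h) u(gh) - u(g)‖²` is bounded by `q u`. -/
def controlledSubgroup (T : Set G) (hT : HasCommonPeriods T)
    (q : (G → Vec (Fin d₁ ⊕ Fin d₂)) → ℝ) : Subgroup G where
  carrier := {h | ∃ C : ℝ, ∀ u, IsPeriodic T u →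
    mean T (fun g => ‖rot (h : Euc (Fin d₁ ⊕ Fin d₂)) (u (g * h)) - u g‖ ^ 2) ≤ C * q u}
  one_mem' := by
    refine ⟨0, fun u hu => ?_⟩
    have h1 : (fun g => ‖rot ((1 : G) : Euc (Fin d₁ ⊕ Fin d₂)) (u (g * 1)) - u g‖ ^ 2) =
        fun g => 0 * ‖u g‖ := by
      ext1 g
      rw [mul_one, Subgroup.coe_one, rot_one, sub_self]
      simp
    rw [h1, mean_const_mul hT 0 (hu.comp fun x => ‖x‖), zero_mul, zero_mul]
  mul_mem' := by
    rintro h k ⟨C, hC⟩ ⟨D, hD⟩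
    -- The increment along `hk` is the one along `h` at `g` plus the rotated one along `k` at `gh`;
    -- the factors come from `(s + t)² ≤ 2s² + 2t²`.
    refine ⟨2 * D + 2 * C, fun u hu => ?_⟩
    have pk : IsPeriodic T fun g => ‖rot (k : Euc (Fin d₁ ⊕ Fin d₂)) (u (g * k)) - u g‖ ^ 2 :=
      (hu.mul_right k).comp₂ hT hu fun a b => ‖rot (k : Euc (Fin d₁ ⊕ Fin d₂)) a - b‖ ^ 2
    have ph : IsPeriodic T fun g => ‖rot (h : Euc (Fin d₁ ⊕ Fin d₂)) (u (g * h)) - u g‖ ^ 2 :=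
      (hu.mul_right h).comp₂ hT hu fun a b => ‖rot (h : Euc (Fin d₁ ⊕ Fin d₂)) a - b‖ ^ 2
    have h1 : ∀ g, ‖rot ((h * k : G) : Euc (Fin d₁ ⊕ Fin d₂)) (u (g * (h * k))) - u g‖ ^ 2 ≤
        2 * ‖rot (k : Euc (Fin d₁ ⊕ Fin d₂)) (u (g * h * k)) - u (g * h)‖ ^ 2 +
        2 * ‖rot (h : Euc (Fin d₁ ⊕ Fin d₂)) (u (g * h)) - u g‖ ^ 2 := by
      intro g
      have h2 : rot ((h * k : G) : Euc (Fin d₁ ⊕ Fin d₂)) (u (g * (h * k))) - u g =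
          rot (h : Euc (Fin d₁ ⊕ Fin d₂))
            (rot (k : Euc (Fin d₁ ⊕ Fin d₂)) (u (g * h * k)) - u (g * h)) +
          (rot (h : Euc (Fin d₁ ⊕ Fin d₂)) (u (g * h)) - u g) := by
        rw [Subgroup.coe_mul, rot_mul, map_sub, mul_assoc]
        abel
      have h3 := norm_add_le (rot (h : Euc (Fin d₁ ⊕ Fin d₂))
            (rot (k : Euc (Fin d₁ ⊕ Fin d₂)) (u (g * h * k)) - u (g * h)))
          (rot (h : Euc (Fin d₁ ⊕ Fin d₂)) (u (g * h)) - u g)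
      rw [← h2, norm_rot] at h3
      nlinarith [norm_nonneg (rot ((h * k : G) : Euc (Fin d₁ ⊕ Fin d₂)) (u (g * (h * k))) - u g),
        sq_nonneg (‖rot (k : Euc (Fin d₁ ⊕ Fin d₂)) (u (g * h * k)) - u (g * h)‖ -
          ‖rot (h : Euc (Fin d₁ ⊕ Fin d₂)) (u (g * h)) - u g‖)]
    have p1 : IsPeriodic T fun g =>
        ‖rot ((h * k : G) : Euc (Fin d₁ ⊕ Fin d₂)) (u (g * (h * k))) - u g‖ ^ 2 :=
      (hu.mul_right (h * k)).comp₂ hT hu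
        fun a b => ‖rot ((h * k : G) : Euc (Fin d₁ ⊕ Fin d₂)) a - b‖ ^ 2
    have p2 := (pk.mul_right h).comp fun x => 2 * x
    have p3 := ph.comp fun x => 2 * x
    refine (mean_mono hT p1 (p2.comp₂ hT p3 (· + ·)) h1).trans ?_
    rw [mean_add hT p2 p3, mean_const_mul hT 2 (pk.mul_right h), mean_const_mul hT 2 ph,
      mean_comp_mul_right hT pk h]
    have := hC u hu
    have := hD u hu
    linarith
  inv_mem' := by
    rintro h ⟨C, hC⟩
    refine ⟨C, fun u hu => ?_⟩
    have ph : IsPeriodic T fun g => ‖rot (h : Euc (Fin d₁ ⊕ Fin d₂)) (u (g * h)) - u g‖ ^ 2 :=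
      (hu.mul_right h).comp₂ hT hu fun a b => ‖rot (h : Euc (Fin d₁ ⊕ Fin d₂)) a - b‖ ^ 2
    refine le_trans (le_of_eq ?_) (hC u hu)
    -- Shifted by `h⁻¹`, the `h`-increment becomes, up to the isometry `rot(h)` and sign, the
    -- `h⁻¹`-increment.
    rw [← mean_comp_mul_right hT ph h⁻¹]
    congr 1
    ext1 g
    rw [inv_mul_cancel_right, ← norm_rot (h : Euc (Fin d₁ ⊕ Fin d₂)), map_sub, ← rot_mul,
      ← Subgroup.coe_mul, mul_inv_cancel, Subgroup.coe_one, rot_one, norm_sub_rev]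

theorem exists_mean_relDisp_le_of_le_one (hd : d₁ ≤ 1) {T : Set G} (hT : HasCommonPeriods T)
    (hne : ∃ N, Admissible T N) (RV : Finset {g : G // g ≠ 1}) {x₀ : Vec (Fin d₁ ⊕ Fin d₂)}
    {R : Finset G} (hR : PropertyTwo x₀ R) :
    ∃ K > 0, ∀ u : Uper T (Vec (Fin d₁ ⊕ Fin d₂)),
      mean T (fun g => ‖relDisp T RV g u‖ ^ 2) ≤ K * meanDeviation T x₀ R fun g => u.1 g := by
  have hle : (R : Set G) ⊆ controlledSubgroup T hT (meanDeviation T x₀ R) := by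
    intro h hh
    refine ⟨4, fun u hu => ?_⟩
    have p1 := (hu.localDisp R).comp fun v => ‖(UisoZZ x₀ R)ᗮ.starProjection v‖ ^ 2
    rw [meanDeviation, ← mean_const_mul hT 4 p1]
    refine mean_mono hT ((hu.mul_right h).comp₂ hT hu
      fun a b => ‖rot (h : Euc (Fin d₁ ⊕ Fin d₂)) a - b‖ ^ 2) (p1.comp fun x => 4 * x) fun g => ?_
    have h1 := norm_rot_sub_le_of_le_one hd x₀ hR.one_mem (localDisp u R g) ⟨h, hh⟩
    simp only [localDisp, mul_one] at h1 ⊢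
    calc _ ≤ (2 * _) ^ 2 := pow_le_pow_left₀ (norm_nonneg _) h1 2
      _ = _ := by ring
  have htop : ∀ h : G, h ∈ controlledSubgroup T hT (meanDeviation T x₀ R) := by
    intro h
    have := (Subgroup.closure_le _).2 hle
    rw [hR.closure_eq_top] at this
    exact this (Subgroup.mem_top h)
  choose C hC using htop
  -- The constants `C h` carry no sign, hence the absolute values; the summand `1` only ensures `K >
  -- 0`.
  refine ⟨∑ h : RV, |C h.1.1| + 1, by positivity, fun u => ?_⟩
  have hu := isPeriodic_of_mem_Uper hT hne u.2
  have hq := meanDeviation_nonneg hT x₀ R hu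
  have h1 : ∀ g, ‖relDisp T RV g u‖ ^ 2 ≤ ∑ h, ‖relDisp T RV g u h‖ ^ 2 := by
    intro g
    have h2 : ‖relDisp T RV g u‖ ≤ √(∑ h, ‖relDisp T RV g u h‖ ^ 2) := by
      refine (pi_norm_le_iff_of_nonneg (Real.sqrt_nonneg _)).2 fun h => ?_
      refine Real.le_sqrt_of_sq_le ?_
      exact Finset.single_le_sum (f := fun h => ‖relDisp T RV g u h‖ ^ 2)
        (fun _ _ => by positivity) (Finset.mem_univ h)
    calc _ ≤ √(∑ h, ‖relDisp T RV g u h‖ ^ 2) ^ 2 := pow_le_pow_left₀ (norm_nonneg _) h2 2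
      _ = _ := Real.sq_sqrt (by positivity)
  have p := (isPeriodicFamily_relDisp hT hne RV).periodic u
  refine (mean_mono hT (p.comp fun w => ‖w‖ ^ 2) (p.comp fun w => ∑ h, ‖w h‖ ^ 2) h1).trans ?_
  rw [mean_sum hT p _ fun h N _ hp => hp.comp fun w => ‖w h‖ ^ 2, add_mul, Finset.sum_mul]
  refine le_add_of_le_of_nonneg (Finset.sum_le_sum fun h _ => ?_) (by linarith)
  exact (hC h.1.1 _ hu).trans (mul_le_mul_of_nonneg_right (le_abs_self _) hq)

end NoRotations

end ObjStruct

/-! ### Optimal alignment of finite configurations -/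

namespace ObjStruct

section Alignment

open scoped RealInnerProductSpace

variable {E : Type} [NormedAddCommGroup E] [InnerProductSpace ℝ E] [FiniteDimensional ℝ E]
  {ι : Type} [Fintype ι]

/-- The isometries form a compact set of operators in finite dimension; a norm-preserving
endomorphism is automatically invertible. -/
theorem exists_isometry_minimizing (a b : ι → E) :
    ∃ Q : E ≃ₗᵢ[ℝ] E, ∀ P : E ≃ₗᵢ[ℝ] E, ∑ i, ‖Q (a i) - b i‖ ^ 2 ≤ ∑ i, ‖P (a i) - b i‖ ^ 2 := by
  let s : Set (E →L[ℝ] E) := {A | ∀ x, ‖A x‖ = ‖x‖}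
  have hclosed : IsClosed s := by
    have : s = ⋂ x, {A : E →L[ℝ] E | ‖A x‖ = ‖x‖} := by ext A; simp [s]
    rw [this]
    exact isClosed_iInter fun x => isClosed_eq (by fun_prop) continuous_const
  have hcompact : IsCompact s := by
    refine (isCompact_closedBall (0 : E →L[ℝ] E) 1).of_isClosed_subset hclosed fun A hA => ?_
    rw [mem_closedBall_zero_iff]
    exact A.opNorm_le_bound zero_le_one fun x => by rw [hA x, one_mul]
  have hne : s.Nonempty := ⟨ContinuousLinearMap.id ℝ E, fun x => rfl⟩
  obtain ⟨A, hA, hmin⟩ := hcompact.exists_isMinOn (f := fun A => ∑ i, ‖A (a i) - b i‖ ^ 2) hne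
    (Continuous.continuousOn (by fun_prop))
  let Q : E →ₗᵢ[ℝ] E := ⟨A.toLinearMap, hA⟩
  refine ⟨Q.toLinearIsometryEquiv rfl, fun P => ?_⟩
  exact hmin (a := P.toLinearIsometry.toContinuousLinearMap) fun x => P.norm_map x

/-- A minimizer `Q` is stationary along the curve `exp(tS) Q` of isometries, which yields the
relation with `S (Q (a i))`. Passing to `S (b i)` is free, because `⟪x, S x⟫ = 0` for skew `S`. -/
theorem exists_isometry_sum_inner_eq_zero (a b : ι → E) :
    ∃ Q : E ≃ₗᵢ[ℝ] E, ∑ i, ‖Q (a i) - b i‖ ^ 2 ≤ ∑ i, ‖a i - b i‖ ^ 2 ∧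
      ∀ S : E →ₗ[ℝ] E, (∀ x y, ⟪S x, y⟫ = -⟪x, S y⟫) → ∑ i, ⟪Q (a i) - b i, S (b i)⟫ = 0 := by
  obtain ⟨Q, hQ⟩ := exists_isometry_minimizing a b
  refine ⟨Q, hQ (LinearIsometryEquiv.refl ℝ E), fun S hS => ?_⟩
  let S' : E →L[ℝ] E := LinearMap.toContinuousLinearMap S
  have hskew : S' ∈ skewAdjoint (E →L[ℝ] E) := by
    rw [skewAdjoint.mem_iff, ContinuousLinearMap.star_eq_adjoint]
    symm
    rw [ContinuousLinearMap.eq_adjoint_iff]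
    intro x y
    change ⟪-S x, y⟫ = ⟪x, S y⟫
    rw [inner_neg_left, hS, neg_neg]
  let _ : NormedAlgebra ℚ (E →L[ℝ] E) := NormedAlgebra.restrictScalars ℚ ℝ _
  let φ : ℝ → ℝ := fun t => ∑ i, ‖NormedSpace.exp (t • S') (Q (a i)) - b i‖ ^ 2
  have hmin : IsLocalMin φ 0 := by
    refine Filter.Eventually.of_forall fun t => ?_
    have hu : NormedSpace.exp (t • S') ∈ unitary (E →L[ℝ] E) :=
      NormedSpace.exp_mem_unitary_of_mem_skewAdjoint (skewAdjoint.smul_mem t hskew)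
    have h0 : φ 0 = ∑ i, ‖Q (a i) - b i‖ ^ 2 := by simp [φ]
    rw [h0]
    exact hQ (Q.trans (Unitary.linearIsometryEquiv ⟨_, hu⟩))
  have hderiv : HasDerivAt φ (∑ i, 2 * ⟪Q (a i) - b i, S (Q (a i))⟫) 0 := by
    refine HasDerivAt.fun_sum fun i _ => ?_
    have h1 : HasDerivAt (fun t : ℝ => NormedSpace.exp (t • S')) S' 0 := by
      simpa using hasDerivAt_exp_smul_const (𝕂 := ℝ) S' (0 : ℝ)
    have h2 : HasDerivAt (fun t : ℝ => NormedSpace.exp (t • S') (Q (a i)) - b i)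
        (S' (Q (a i))) 0 := by
      have := h1.clm_apply (hasDerivAt_const (0 : ℝ) (Q (a i)))
      simpa using this.sub_const (b i)
    have h3 := h2.norm_sq
    simp only [zero_smul, NormedSpace.exp_zero] at h3
    exact h3
  have hzero := hmin.hasDerivAt_eq_zero hderiv
  rw [← Finset.mul_sum] at hzero
  have hzero' : ∑ i, ⟪Q (a i) - b i, S (Q (a i))⟫ = 0 := by linarith
  rw [← hzero']
  refine Finset.sum_congr rfl fun i _ => ?_
  have h4 : ⟪Q (a i) - b i, S (Q (a i) - b i)⟫ = 0 := by
    have h5 := hS (Q (a i) - b i) (Q (a i) - b i)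
    rw [real_inner_comm] at h5
    linarith
  rw [map_sub, inner_sub_right] at h4
  linarith

/-- Centre both configurations at their barycentres and rotate optimally. The residuals then sum to
zero, which handles constant fields; stationarity in the rotation handles `S (y₀ i - m₀)`, and
changing the centre from `m₀` to `p` adds only a constant. -/
theorem exists_optimal_alignment [Nonempty ι] {y y₀ : ι → E} {r : ℝ}
    (hr : ∀ i, ‖y i - y₀ i‖ ≤ r) :
    ∃ (Q : E ≃ₗᵢ[ℝ] E) (c : E), (∀ i, ‖Q (y i) + c - y₀ i‖ ≤ 2 * Fintype.card ι * r) ∧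
      ∀ (e p : E) (S : E →ₗ[ℝ] E), (∀ x y, ⟪S x, y⟫ = -⟪x, S y⟫) →
        ∑ i, ⟪Q (y i) + c - y₀ i, e + S (y₀ i - p)⟫ = 0 := by
  obtain ⟨n, hn⟩ : ∃ n : ℝ, n = Fintype.card ι := ⟨_, rfl⟩
  rw [← hn]
  have hn1 : 1 ≤ n := by
    rw [hn]
    exact_mod_cast Fintype.card_pos (α := ι)
  have hn0 : n ≠ 0 := by positivity
  have hr0 : 0 ≤ r := (norm_nonneg _).trans (hr (Classical.arbitrary ι))
  let m : E := n⁻¹ • ∑ i, y i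
  let m₀ : E := n⁻¹ • ∑ i, y₀ i
  have hm : ‖m - m₀‖ ≤ r := by
    have h1 : m - m₀ = n⁻¹ • ∑ i, (y i - y₀ i) := by
      rw [Finset.sum_sub_distrib, smul_sub]
    have h2 : ‖∑ i, (y i - y₀ i)‖ ≤ n * r := by
      refine (norm_sum_le _ _).trans ((Finset.sum_le_sum fun i _ => hr i).trans_eq ?_)
      rw [Finset.sum_const, Finset.card_univ, nsmul_eq_mul, hn]
    rw [h1, norm_smul, norm_inv, Real.norm_of_nonneg (by positivity : 0 ≤ n)]
    rwa [inv_mul_le_iff₀ (by positivity)]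
  have hcenter : ∀ x : ι → E, ∑ i, (x i - n⁻¹ • ∑ j, x j) = 0 := by
    intro x
    rw [Finset.sum_sub_distrib, Finset.sum_const, Finset.card_univ, ← Nat.cast_smul_eq_nsmul ℝ,
      ← hn, smul_inv_smul₀ hn0, sub_self]
  obtain ⟨Q, hle, horth⟩ :=
    exists_isometry_sum_inner_eq_zero (fun i => y i - m) (fun i => y₀ i - m₀)
  have hd : ∀ i, Q (y i) + (m₀ - Q m) - y₀ i = Q (y i - m) - (y₀ i - m₀) := by
    intro i
    rw [map_sub]
    abel
  have hsum : ∑ i, (Q (y i - m) - (y₀ i - m₀)) = 0 := by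
    rw [Finset.sum_sub_distrib, ← map_sum, hcenter y, hcenter y₀, map_zero, sub_zero]
  refine ⟨Q, m₀ - Q m, fun i => ?_, fun e p S hS => ?_⟩
  · rw [hd]
    refine le_of_sq_le_sq ?_ (by positivity)
    calc ‖Q (y i - m) - (y₀ i - m₀)‖ ^ 2 ≤ ∑ i, ‖Q (y i - m) - (y₀ i - m₀)‖ ^ 2 :=
          Finset.single_le_sum (f := fun i => ‖Q (y i - m) - (y₀ i - m₀)‖ ^ 2)
            (fun _ _ => by positivity) (Finset.mem_univ i)
      _ ≤ ∑ i, ‖y i - m - (y₀ i - m₀)‖ ^ 2 := hle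
      _ ≤ ∑ _i : ι, (2 * r) ^ 2 := by
          refine Finset.sum_le_sum fun i _ => pow_le_pow_left₀ (norm_nonneg _) ?_ 2
          rw [sub_sub_sub_comm, two_mul]
          exact (norm_sub_le _ _).trans (add_le_add (hr i) hm)
      _ = n * (2 * r) ^ 2 := by
          rw [Finset.sum_const, Finset.card_univ, nsmul_eq_mul, hn]
      -- Here `n ≤ n²`, as the index set is nonempty.
      _ ≤ (2 * n * r) ^ 2 := by nlinarith [sq_nonneg r]
  · have h1 : ∀ i, ⟪Q (y i) + (m₀ - Q m) - y₀ i, e + S (y₀ i - p)⟫ =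
        ⟪Q (y i - m) - (y₀ i - m₀), e + S (m₀ - p)⟫ +
        ⟪Q (y i - m) - (y₀ i - m₀), S (y₀ i - m₀)⟫ := by
      intro i
      rw [hd, ← inner_add_right, add_assoc, ← map_add]
      congr 3
      abel
    rw [Finset.sum_congr rfl fun i _ => h1 i, Finset.sum_add_distrib, ← sum_inner, hsum,
      inner_zero_left, horth S hS, add_zero]

end Alignment

/-! ### Rigidity: local infinitesimal isometries are global -/

section Kernel

variable {d₁ d₂ : ℕ} {G : Subgroup (Euc (Fin d₁ ⊕ Fin d₂))}

theorem mem_UisoZZ_iff {x₀ : Vec (Fin d₁ ⊕ Fin d₂)} {R : Finset G} {v : LocalDisp R} :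
    v ∈ UisoZZ x₀ R ↔ ∃ a, ∃ S ∈ skewZZ d₁ d₂, ∀ h : R,
      rot (h.1 : Euc (Fin d₁ ⊕ Fin d₂)) (v h) =
        a + Matrix.toEuclideanLin S ((h.1 : Euc (Fin d₁ ⊕ Fin d₂)) x₀ - x₀) := by
  rw [UisoZZ, Submodule.mem_sup]
  constructor
  · rintro ⟨v₁, ⟨a, ha⟩, v₂, ⟨S, hS, hv⟩, rfl⟩
    exact ⟨a, S, hS, fun h => by rw [PiLp.add_apply, map_add, ha, hv]⟩
  · rintro ⟨a, S, hS, hv⟩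
    refine ⟨WithLp.toLp 2 fun h : R => (rot (h.1 : Euc (Fin d₁ ⊕ Fin d₂))).symm a,
      ⟨a, fun h => LinearIsometryEquiv.apply_symm_apply _ _⟩,
      v - WithLp.toLp 2 fun h : R => (rot (h.1 : Euc (Fin d₁ ⊕ Fin d₂))).symm a,
      ⟨S, hS, fun h => ?_⟩, add_sub_cancel _ _⟩
    rw [PiLp.sub_apply, map_sub, hv]
    change _ - rot _ ((rot _).symm a) = _
    rw [LinearIsometryEquiv.apply_symm_apply, add_sub_cancel_left]

theorem rot_coe_sub (g h k : G) (x₀ : Vec (Fin d₁ ⊕ Fin d₂)) :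
    rot (g : Euc (Fin d₁ ⊕ Fin d₂)) ((h : Euc (Fin d₁ ⊕ Fin d₂)) x₀ -
      (k : Euc (Fin d₁ ⊕ Fin d₂)) x₀) = ((g * h : G) : Euc (Fin d₁ ⊕ Fin d₂)) x₀ -
      ((g * k : G) : Euc (Fin d₁ ⊕ Fin d₂)) x₀ := by
  rw [coe_mul_apply, coe_mul_apply, euc_sub]

/-- Displacements which are infinitesimal isometries on all translates of `R` are infinitesimal
isometries. -/
theorem exists_skew_of_forall_localDisp_mem {x₀ : Vec (Fin d₁ ⊕ Fin d₂)} {R : Finset G}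
    (hR : PropertyTwo x₀ R) {u : G → Vec (Fin d₁ ⊕ Fin d₂)}
    (hu : ∀ g, localDisp u R g ∈ UisoZZ x₀ R) :
    ∃ a, ∃ S ∈ skewZZ d₁ d₂, ∀ g : G, rot (g : Euc (Fin d₁ ⊕ Fin d₂)) (u g) =
      a + Matrix.toEuclideanLin S ((g : Euc (Fin d₁ ⊕ Fin d₂)) x₀ - x₀) := by
  have hR1 := hR.one_mem
  obtain ⟨R', R'', h1', hgen, ⟨-, h1'', haff⟩, hsub⟩ := hR
  simp only [mem_UisoZZ_iff] at hu
  choose a S hS hu using hu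
  let p : G → Vec (Fin d₁ ⊕ Fin d₂) := fun g => (g : Euc (Fin d₁ ⊕ Fin d₂)) x₀
  let v : G → Vec (Fin d₁ ⊕ Fin d₂) := fun g => rot (g : Euc (Fin d₁ ⊕ Fin d₂)) (u g)
  -- Conjugation by `rot(g)` expresses the local matrices `S g` in one common frame, so that they
  -- can be compared.
  let A : G → Vec (Fin d₁ ⊕ Fin d₂) →ₗ[ℝ] Vec (Fin d₁ ⊕ Fin d₂) := fun g =>
    (rot (g : Euc (Fin d₁ ⊕ Fin d₂))).toLinearEquiv.toLinearMap ∘ₗ Matrix.toEuclideanLin (S g) ∘ₗ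
      (rot (g⁻¹ : Euc (Fin d₁ ⊕ Fin d₂))).toLinearEquiv.toLinearMap
  have hA : ∀ g x, A g (rot (g : Euc (Fin d₁ ⊕ Fin d₂)) x) =
      rot (g : Euc (Fin d₁ ⊕ Fin d₂)) (Matrix.toEuclideanLin (S g) x) := by
    intro g x
    change rot (g : Euc (Fin d₁ ⊕ Fin d₂)) (Matrix.toEuclideanLin (S g)
      (rot (g⁻¹ : Euc (Fin d₁ ⊕ Fin d₂)) (rot (g : Euc (Fin d₁ ⊕ Fin d₂)) x))) = _
    rw [rot_inv_rot]
  have hloc : ∀ g h, h ∈ R → v (g * h) = v g + A g (p (g * h) - p g) := by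
    have hv : ∀ g h, h ∈ R → v (g * h) =
        rot (g : Euc (Fin d₁ ⊕ Fin d₂)) (a g) + A g (p (g * h) - p g) := by
      intro g h hh
      have h2 : p (g * h) - p g = rot (g : Euc (Fin d₁ ⊕ Fin d₂)) (p h - p 1) := by
        rw [rot_coe_sub, mul_one]
      rw [h2, hA, ← map_add]
      exact congrArg (rot (g : Euc (Fin d₁ ⊕ Fin d₂))) (hu g ⟨h, hh⟩)
    intro g h hh
    have h3 := hv g 1 hR1
    rw [mul_one, sub_self, map_zero, add_zero] at h3
    rw [hv g h hh, h3]
  -- The patches at `g` and at `gr` both contain `g r R''`, and `R'' · x₀` affinely spans the orbit.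
  -- Hence the two local maps agree on all orbit directions, though not necessarily elsewhere.
  have hstep : ∀ g, ∀ r ∈ R', ∀ w ∈ vectorSpan ℝ (Set.range p),
      A g (rot ((g * r : G) : Euc (Fin d₁ ⊕ Fin d₂)) w) =
        A (g * r) (rot ((g * r : G) : Euc (Fin d₁ ⊕ Fin d₂)) w) := by
    intro g r hr w hw
    have h2 : vectorSpan ℝ (Set.range p) = vectorSpan ℝ (p '' R'') := by
      rw [← direction_affineSpan, ← direction_affineSpan, ← haff]
    rw [h2, vectorSpan_eq_span_vsub_set_right ℝ (Set.mem_image_of_mem p h1'')] at hw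
    induction hw using Submodule.span_induction with
    | mem x hx =>
      obtain ⟨_, ⟨k, hk, rfl⟩, rfl⟩ := hx
      have h3 : rot ((g * r : G) : Euc (Fin d₁ ⊕ Fin d₂)) (p k -ᵥ p 1) =
          p (g * r * k) - p (g * r) := by
        have := rot_coe_sub (g * r) k 1 x₀
        rwa [mul_one] at this
      have hr1 : r ∈ R := hsub ⟨r, hr, 1, h1'', mul_one r⟩
      have hk1 : k ∈ R := hsub ⟨1, h1', k, hk, one_mul k⟩
      have hrk : r * k ∈ R := hsub ⟨r, hr, k, hk, rfl⟩
      have e1 := hloc g (r * k) hrk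
      have e2 := hloc (g * r) k hk1
      have e3 := hloc g r hr1
      rw [← mul_assoc] at e1
      have e4 : A g (p (g * r * k) - p (g * r)) =
          A g (p (g * r * k) - p g) - A g (p (g * r) - p g) := by
        rw [← map_sub, sub_sub_sub_cancel_right]
      rw [h3, e4]
      rw [e1, e3, add_assoc] at e2
      rw [add_left_cancel e2, add_sub_cancel_left]
    | zero => simp only [map_zero]
    | add x y _ _ hx hy => simp only [map_add, hx, hy]
    | smul c x _ hx => simp only [map_smul, hx]
  have hstep' : ∀ g, ∀ r ∈ R', ∀ k l, A (g * r) (p k - p l) = A g (p k - p l) := by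
    intro g r hr k l
    have h2 := hstep g r hr (p ((g * r)⁻¹ * k) - p ((g * r)⁻¹ * l))
      (vsub_mem_vectorSpan ℝ ⟨_, rfl⟩ ⟨_, rfl⟩)
    rw [rot_coe_sub, mul_inv_cancel_left, mul_inv_cancel_left] at h2
    exact h2.symm
  -- The elements along which the local map does not change form a subgroup containing the
  -- generators `R'`.
  have hconst : ∀ h g k l, A (g * h) (p k - p l) = A g (p k - p l) := by
    let H : Subgroup G :=
      { carrier := {h | ∀ g k l, A (g * h) (p k - p l) = A g (p k - p l)}
        one_mem' := fun g k l => by rw [mul_one]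
        mul_mem' := fun {h h'} hh hh' g k l => by rw [← mul_assoc, hh', hh]
        inv_mem' := fun {h} hh g k l => by
          have := hh (g * h⁻¹) k l
          rwa [inv_mul_cancel_right, eq_comm] at this }
    have hH : Subgroup.closure R' ≤ H := (Subgroup.closure_le H).2 fun r hr g k l =>
      hstep' g r hr k l
    rw [hgen] at hH
    exact fun h => hH (Subgroup.mem_top h)
  have hconst' : ∀ h k l, A h (p k - p l) = A 1 (p k - p l) := fun h k l => by
    have := hconst h 1 k l
    rwa [one_mul] at this
  -- Increments of `v` telescope, so the identity for generators extends to the whole group.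
  have hincr : ∀ h g, v (g * h) - v g = A 1 (p (g * h) - p g) := by
    let H : Subgroup G :=
      { carrier := {h | ∀ g, v (g * h) - v g = A 1 (p (g * h) - p g)}
        one_mem' := fun g => by rw [mul_one, sub_self, sub_self, map_zero]
        mul_mem' := fun {h h'} hh hh' g => by
          rw [← mul_assoc, ← sub_add_sub_cancel _ (v (g * h)), hh g, hh' (g * h), ← map_add,
            sub_add_sub_cancel]
        inv_mem' := fun {h} hh g => by
          have := hh (g * h⁻¹)
          rw [inv_mul_cancel_right] at this
          rw [← neg_sub, this, ← map_neg, neg_sub] }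
    have hH : Subgroup.closure R' ≤ H := (Subgroup.closure_le H).2 fun r hr g => by
      rw [hloc g r (hsub ⟨r, hr, 1, h1'', mul_one r⟩), add_sub_cancel_left, hconst']
    rw [hgen] at hH
    exact fun h => hH (Subgroup.mem_top h)
  refine ⟨v 1, S 1, hS 1, fun g => ?_⟩
  have h2 := hincr g 1
  rw [one_mul, sub_eq_iff_eq_add'] at h2
  have h3 := hA 1 (p g - p 1)
  rw [Subgroup.coe_one, rot_one, rot_one] at h3
  rw [h3] at h2
  exact h2

end Kernel

end ObjStruct

/-! ### Local minimality: the case of finite groups -/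

namespace ObjStruct

open scoped RealInnerProductSpace

section FiniteGroup

variable {d₁ d₂ : ℕ} {G : Subgroup (Euc (Fin d₁ ⊕ Fin d₂))}

theorem mean_eq_sum [Fintype G] {T : Set G} (hT : HasCommonPeriods T) {N : ℕ}
    (hN : Admissible T N) (hbot : powGroup T N = ⊥) (f : G → ℝ) :
    mean T f = (Fintype.card G : ℝ)⁻¹ * ∑ g, f g := by
  have hf : ∀ g : G, ∀ t ∈ (⊥ : Subgroup G), f g = f (g * t) := by
    intro g t ht
    rw [Subgroup.mem_bot.1 ht, mul_one]
  have hf' : PeriodicWith T N f := by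
    rw [PeriodicWith, hbot]
    exact hf
  let e : G ≃ G ⧸ (⊥ : Subgroup G) := QuotientGroup.quotientBot.symm.toEquiv
  rw [mean_eq_cellMean hT hN hf', hbot, cellMean, ← Nat.card_congr e, Nat.card_eq_fintype_card,
    ← finsum_comp_equiv e, finsum_eq_sum_of_fintype]
  exact congrArg _ (Finset.sum_congr rfl fun g _ => apply_quotient_out hf g)

theorem inner_toEuclideanLin_of_mem_skewZZ {S : Matrix (Fin d₁ ⊕ Fin d₂) (Fin d₁ ⊕ Fin d₂) ℝ}
    (hS : S ∈ skewZZ d₁ d₂) (x y : Vec (Fin d₁ ⊕ Fin d₂)) :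
    ⟪Matrix.toEuclideanLin S x, y⟫ = -⟪x, Matrix.toEuclideanLin S y⟫ := by
  have h1 : S.conjTranspose = -S := by
    rw [Matrix.conjTranspose_eq_transpose_of_trivial]
    exact hS.1
  rw [← LinearMap.adjoint_inner_right, ← Matrix.toEuclideanLin_conjTranspose_eq_adjoint, h1,
    map_neg, LinearMap.neg_apply, inner_neg_right]

/-- The displacements orthogonal to all infinitesimal isometries. -/
noncomputable def orthogonalDisp [Fintype G] (x₀ : Vec (Fin d₁ ⊕ Fin d₂)) :
    Submodule ℝ (G → Vec (Fin d₁ ⊕ Fin d₂)) where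
  carrier := {u | ∀ a, ∀ S ∈ skewZZ d₁ d₂, ∑ g : G, ⟪rot (g : Euc (Fin d₁ ⊕ Fin d₂)) (u g),
    a + Matrix.toEuclideanLin S ((g : Euc (Fin d₁ ⊕ Fin d₂)) x₀ - x₀)⟫ = 0}
  add_mem' := by
    intro u v hu hv a S hS
    simp only [Pi.add_apply, map_add, inner_add_left, Finset.sum_add_distrib]
    rw [hu a S hS, hv a S hS, add_zero]
  zero_mem' := by
    intro a S hS
    simp only [Pi.zero_apply, map_zero, inner_zero_left, Finset.sum_const_zero]
  smul_mem' := by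
    intro c u hu a S hS
    simp only [Pi.smul_apply, map_smul, real_inner_smul_left, ← Finset.mul_sum]
    rw [hu a S hS, mul_zero]

/-- The map `u ↦` (projected local displacements) is injective on this subspace, and an injective
linear map on a finite-dimensional space is bounded below. -/
theorem exists_norm_le_of_mem_orthogonalDisp [Fintype G] {x₀ : Vec (Fin d₁ ⊕ Fin d₂)}
    {R : Finset G} (hR : PropertyTwo x₀ R) :
    ∃ C > 0, ∀ u ∈ orthogonalDisp (G := G) x₀, ∀ g,
      ‖u g‖ ^ 2 ≤ C * ∑ g, ‖(UisoZZ x₀ R)ᗮ.starProjection (localDisp u R g)‖ ^ 2 := by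
  let A : orthogonalDisp (G := G) x₀ →ₗ[ℝ] (G → LocalDisp R) :=
    { toFun := fun u g => (UisoZZ x₀ R)ᗮ.starProjection (localDisp u.1 R g)
      map_add' := fun u v => by
        ext1 g
        rw [Pi.add_apply, ← map_add]
        rfl
      map_smul' := fun c u => by
        ext1 g
        rw [RingHom.id_apply, Pi.smul_apply, ← map_smul]
        rfl }
  have hker : LinearMap.ker A = ⊥ := by
    rw [LinearMap.ker_eq_bot']
    intro u hu
    have h1 : ∀ g, localDisp u.1 R g ∈ UisoZZ x₀ R := by
      intro g
      have := congrFun hu g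
      rw [← Submodule.orthogonal_orthogonal (UisoZZ x₀ R)]
      exact (Submodule.starProjection_apply_eq_zero_iff _).1 this
    obtain ⟨a, S, hS, h2⟩ := exists_skew_of_forall_localDisp_mem hR h1
    -- By rigidity `u` is itself an infinitesimal isometry, so orthogonality tested against `u`
    -- gives `∑ ‖u g‖² = 0`.
    have h3 := u.2 a S hS
    simp only [← h2, real_inner_self_eq_norm_sq, norm_rot] at h3
    rw [Finset.sum_eq_zero_iff_of_nonneg fun _ _ => by positivity] at h3
    refine Subtype.ext (funext fun g => ?_)
    simpa using h3 g (Finset.mem_univ g)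
  obtain ⟨K, hK, hA⟩ := A.exists_antilipschitzWith hker
  refine ⟨(K : ℝ) ^ 2, by positivity, fun u hu g => ?_⟩
  have h1 : ‖(⟨u, hu⟩ : orthogonalDisp (G := G) x₀)‖ ≤ K * ‖A ⟨u, hu⟩‖ := by
    simpa using hA.le_mul_dist (⟨u, hu⟩ : orthogonalDisp (G := G) x₀) 0
  have h2 : ‖A ⟨u, hu⟩‖ ≤
      √(∑ g, ‖(UisoZZ x₀ R)ᗮ.starProjection (localDisp u R g)‖ ^ 2) := by
    refine (pi_norm_le_iff_of_nonneg (Real.sqrt_nonneg _)).2 fun h => ?_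
    refine Real.le_sqrt_of_sq_le ?_
    exact Finset.single_le_sum
      (f := fun g => ‖(UisoZZ x₀ R)ᗮ.starProjection (localDisp u R g)‖ ^ 2)
      (fun _ _ => by positivity) (Finset.mem_univ h)
  have h3 : ‖u g‖ ≤ K * √(∑ g, ‖(UisoZZ x₀ R)ᗮ.starProjection (localDisp u R g)‖ ^ 2) :=
    (norm_le_pi_norm u g).trans (h1.trans (mul_le_mul_of_nonneg_left h2 K.2))
  calc ‖u g‖ ^ 2 ≤ (K * √(∑ g, ‖(UisoZZ x₀ R)ᗮ.starProjection (localDisp u R g)‖ ^ 2)) ^ 2 :=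
        pow_le_pow_left₀ (norm_nonneg _) h3 2
    _ = _ := by rw [mul_pow, Real.sq_sqrt (by positivity)]

theorem exists_mean_relDisp_le_of_finite [Fintype G] {T : Set G} (hT : HasCommonPeriods T)
    {N : ℕ} (hN : Admissible T N) (hbot : powGroup T N = ⊥) (RV : Finset {g : G // g ≠ 1})
    {x₀ : Vec (Fin d₁ ⊕ Fin d₂)} {R : Finset G} (hR : PropertyTwo x₀ R) :
    ∃ K > 0, ∀ u : Uper T (Vec (Fin d₁ ⊕ Fin d₂)), (fun g => u.1 g) ∈ orthogonalDisp x₀ →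
      mean T (fun g => ‖relDisp T RV g u‖ ^ 2) ≤ K * meanDeviation T x₀ R fun g => u.1 g := by
  obtain ⟨C, hC, hle⟩ := exists_norm_le_of_mem_orthogonalDisp (G := G) hR
  have hn : (0 : ℝ) < Fintype.card G := by exact_mod_cast Fintype.card_pos
  refine ⟨4 * C * Fintype.card G, by positivity, fun u hu => ?_⟩
  rw [meanDeviation, mean_eq_sum hT hN hbot, mean_eq_sum hT hN hbot]
  set s := ∑ g, ‖(UisoZZ x₀ R)ᗮ.starProjection (localDisp (fun g => u.1 g) R g)‖ ^ 2
  have hs : 0 ≤ s := Finset.sum_nonneg fun _ _ => by positivity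
  have hu' : ∀ g, ‖u.1 g‖ ≤ √(C * s) := fun g => Real.le_sqrt_of_sq_le (hle _ hu g)
  have h1 : ∀ g, ‖relDisp T RV g u‖ ^ 2 ≤ 4 * C * s := by
    intro g
    have h2 : ‖relDisp T RV g u‖ ≤ 2 * √(C * s) := by
      refine (pi_norm_le_iff_of_nonneg (by positivity)).2 fun h => ?_
      rw [relDisp_apply, two_mul]
      refine (norm_sub_le _ _).trans (add_le_add ?_ (hu' g))
      rw [norm_rot]
      exact hu' _
    calc _ ≤ (2 * √(C * s)) ^ 2 := pow_le_pow_left₀ (norm_nonneg _) h2 2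
      _ = _ := by rw [mul_pow, Real.sq_sqrt (by positivity)]; ring
  have h2 : ∑ g, ‖relDisp T RV g u‖ ^ 2 ≤ Fintype.card G * (4 * C * s) := by
    refine (Finset.sum_le_sum fun g _ => h1 g).trans_eq ?_
    rw [Finset.sum_const, Finset.card_univ, nsmul_eq_mul]
  calc _ ≤ (Fintype.card G : ℝ)⁻¹ * (Fintype.card G * (4 * C * s)) := by gcongr
    _ = _ := by field_simp

/-- Up to a Euclidean motion, small displacements of finite structures are small and orthogonal to
the infinitesimal isometries. -/
theorem exists_aligned_displacement [Fintype G] {T : Set G} {N : ℕ} (hN : Admissible T N)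
    (hbot : powGroup T N = ⊥) {V : Config G → ℝ} (hV : OrthInvariant V)
    (x₀ : Vec (Fin d₁ ⊕ Fin d₂)) (u : Uper T (Vec (Fin d₁ ⊕ Fin d₂))) :
    ∃ u' : Uper T (Vec (Fin d₁ ⊕ Fin d₂)), (fun g => u'.1 g) ∈ orthogonalDisp x₀ ∧
      ‖u'‖ ≤ 2 * Fintype.card G * ‖u‖ ∧ ∀ g : G,
      V (fun h => ((g * h.1 : G) : Euc (Fin d₁ ⊕ Fin d₂)) (x₀ + u'.1 (g * h.1)) -
        (g : Euc (Fin d₁ ⊕ Fin d₂)) (x₀ + u'.1 g)) =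
      V (fun h => ((g * h.1 : G) : Euc (Fin d₁ ⊕ Fin d₂)) (x₀ + u.1 (g * h.1)) -
        (g : Euc (Fin d₁ ⊕ Fin d₂)) (x₀ + u.1 g)) := by
  let y : G → Vec (Fin d₁ ⊕ Fin d₂) := fun g => (g : Euc (Fin d₁ ⊕ Fin d₂)) (x₀ + u.1 g)
  let y₀ : G → Vec (Fin d₁ ⊕ Fin d₂) := fun g => (g : Euc (Fin d₁ ⊕ Fin d₂)) x₀
  have hy : ∀ g, ‖y g - y₀ g‖ ≤ ‖u‖ := by
    intro g
    change ‖(g : Euc (Fin d₁ ⊕ Fin d₂)) (x₀ + u.1 g) - (g : Euc (Fin d₁ ⊕ Fin d₂)) x₀‖ ≤ _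
    rw [euc_sub, add_sub_cancel_left, norm_rot]
    exact norm_apply_le_norm T u g
  obtain ⟨Q, c, hle, horth⟩ := exists_optimal_alignment hy
  let w : G → Vec (Fin d₁ ⊕ Fin d₂) := fun g =>
    (rot (g : Euc (Fin d₁ ⊕ Fin d₂))).symm (Q (y g) + c - y₀ g)
  have hw : ∀ g : G, rot (g : Euc (Fin d₁ ⊕ Fin d₂)) (w g) = Q (y g) + c - y₀ g := fun g =>
    LinearIsometryEquiv.apply_symm_apply _ _
  let w' : Bdd G (Vec (Fin d₁ ⊕ Fin d₂)) := ⟨w, Memℓp.all (p := ∞) (E := fun _ : G => Vec (Fin d₁ ⊕ Fin d₂)) w⟩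
  have hw' : w' ∈ Uper T (Vec (Fin d₁ ⊕ Fin d₂)) := by
    refine mem_Uper_of_periodicWith hN ?_
    intro g t ht
    rw [hbot, Subgroup.mem_bot] at ht
    rw [ht, mul_one]
  -- The new displacement describes the rigidly moved structure: `c` cancels in differences and `Q`
  -- is absorbed by `V`.
  have hpos : ∀ g : G, (g : Euc (Fin d₁ ⊕ Fin d₂)) (x₀ + w g) = Q (y g) + c := by
    intro g
    rw [euc_add, hw]
    exact add_sub_cancel _ _
  refine ⟨⟨w', hw'⟩, fun a S hS => ?_, ?_, fun g => ?_⟩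
  · change ∑ g : G, ⟪rot (g : Euc (Fin d₁ ⊕ Fin d₂)) (w g), _⟫ = 0
    simp only [hw]
    exact horth a x₀ _ (inner_toEuclideanLin_of_mem_skewZZ hS)
  · refine lp.norm_le_of_forall_le (by positivity) fun g => ?_
    change ‖w g‖ ≤ _
    rw [← norm_rot (g : Euc (Fin d₁ ⊕ Fin d₂)), hw]
    exact hle g
  · change V (fun h => ((g * h.1 : G) : Euc (Fin d₁ ⊕ Fin d₂)) (x₀ + w (g * h.1)) -
        (g : Euc (Fin d₁ ⊕ Fin d₂)) (x₀ + w g)) = V fun h => y (g * h.1) - y g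
    simp only [hpos, add_sub_add_right_eq_sub, ← map_sub]
    exact hV Q _

theorem isLocalMin_of_finite [Fintype G] {T : Set G} (hT : HasCommonPeriods T) {N : ℕ}
    (hN : Admissible T N) (hbot : powGroup T N = ⊥) {V : Config G → ℝ} (hV_inv : OrthInvariant V)
    (hV : SmoothPotential V) {RV : Finset {g : G // g ≠ 1}} (hRV : IsInteractionRange V RV)
    {x₀ : Vec (Fin d₁ ⊕ Fin d₂)} (heV : eVec V x₀ = 0) {R : Finset G} (hR : PropertyTwo x₀ R)
    (hstable : 0 < stabilityConstant T V x₀ R) : IsLocalMin (displacedEnergy T V x₀) 0 := by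
  obtain ⟨K, hK, hcontrol⟩ := exists_mean_relDisp_le_of_finite hT hN hbot RV hR
  obtain ⟨δ, hδ, hmin⟩ :=
    exists_forall_displacedEnergy_le hT ⟨N, hN⟩ hV_inv hV hRV heV hstable hK
  have hn : (0 : ℝ) < Fintype.card G := by exact_mod_cast Fintype.card_pos
  -- Alignment may enlarge the norm by the factor `2 * Fintype.card G`.
  filter_upwards [Metric.closedBall_mem_nhds (0 : Uper T (Vec (Fin d₁ ⊕ Fin d₂)))
    (show 0 < δ / (2 * Fintype.card G) by positivity)] with u hu
  rw [mem_closedBall_zero_iff, le_div_iff₀ (by positivity), mul_comm] at hu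
  obtain ⟨u', horth, hnorm, henergy⟩ := exists_aligned_displacement hN hbot hV_inv x₀ u
  have heq : displacedEnergy T V x₀ u' = displacedEnergy T V x₀ u := by
    rw [displacedEnergy_eq_mean hT ⟨N, hN⟩ hV_inv hRV,
      displacedEnergy_eq_mean hT ⟨N, hN⟩ hV_inv hRV]
    simp only [← potential_displaced hV_inv hRV, henergy]
  rw [← heq]
  exact hmin u' (hnorm.trans hu) (hcontrol u' horth)

end FiniteGroup

theorem isLocalMin_of_le_one {d₁ d₂ : ℕ} (hd : d₁ ≤ 1) {G : Subgroup (Euc (Fin d₁ ⊕ Fin d₂))}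
    {T : Set G} (hT : HasCommonPeriods T) (hne : ∃ N, Admissible T N) {V : Config G → ℝ}
    (hV_inv : OrthInvariant V) (hV : SmoothPotential V) {RV : Finset {g : G // g ≠ 1}}
    (hRV : IsInteractionRange V RV) {x₀ : Vec (Fin d₁ ⊕ Fin d₂)} (heV : eVec V x₀ = 0)
    {R : Finset G} (hR : PropertyTwo x₀ R) (hstable : 0 < stabilityConstant T V x₀ R) :
    IsLocalMin (displacedEnergy T V x₀) 0 := by
  obtain ⟨K, hK, hcontrol⟩ := exists_mean_relDisp_le_of_le_one hd hT hne RV hR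
  obtain ⟨δ, hδ, hmin⟩ := exists_forall_displacedEnergy_le hT hne hV_inv hV hRV heV hstable hK
  filter_upwards [Metric.closedBall_mem_nhds (0 : Uper T (Vec (Fin d₁ ⊕ Fin d₂))) hδ] with u hu
  exact hmin u (mem_closedBall_zero_iff.1 hu) (hcontrol u)

/-- In dimension zero all shifts are `0`, so `T` has at most one element; its power `T^N` contains
`1` and is therefore trivial. -/
theorem IsTranslationSection.powGroup_eq_bot {d₁ : ℕ} {G : Subgroup (Euc (Fin d₁ ⊕ Fin 0))}
    {S : Subgroup (Euc (Fin 0))} {T : Set G} (hT : IsTranslationSection G S T) {N : ℕ}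
    (hN : Admissible T N) : powGroup T N = ⊥ := by
  have hshift : ∀ t : G, HasShift (t : Euc (Fin d₁ ⊕ Fin 0)) 0 := fun t x => Subsingleton.elim _ _
  obtain ⟨r, hr, hr1⟩ := hN.mem_iff.1 (one_mem _)
  rw [Subgroup.eq_bot_iff_forall]
  intro g hg
  obtain ⟨t, ht, rfl⟩ := hN.mem_iff.1 hg
  rw [hT.eq_of_hasShift ht hr (hshift t) (hshift r), hr1]

end ObjStruct

/-! ### Assembly of the cases -/

theorem mainTheorem3 {d₁ d₂ : ℕ} (hd : d₁ ∈ ({0, 1, d₁ + d₂} : Set ℕ))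
    (S : Subgroup (ObjStruct.Euc (Fin d₂))) (hS : ObjStruct.IsSpaceGroup S)
    (G : Subgroup (ObjStruct.Euc (Fin d₁ ⊕ Fin d₂))) (hG : ObjStruct.IsDiscreteGroup G)
    (hGS : ObjStruct.IsSubgroupOver G S)
    (T : Set G) (hT : ObjStruct.IsTranslationSection G S T)
    (x₀ : ObjStruct.Vec (Fin d₁ ⊕ Fin d₂))
    (hx₀ : Function.Injective fun g : G => (g : ObjStruct.Euc (Fin d₁ ⊕ Fin d₂)) x₀)
    (V : ObjStruct.Config G → ℝ) (hV_inv : ObjStruct.OrthInvariant V)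
    (hV_smooth : ObjStruct.SmoothPotential V) (hV_range : ObjStruct.HasFiniteRange V)
    (R : Finset G) (hR : ObjStruct.PropertyTwo x₀ R)
    (heV : ObjStruct.eVec V x₀ = 0)
    (hstable : 0 < ObjStruct.stabilityConstant T V x₀ R) :
    IsLocalMin (ObjStruct.displacedEnergy T V x₀) 0 := by
  have hper := hT.hasCommonPeriods hS hG hGS hx₀
  by_cases hne : ∃ N, ObjStruct.Admissible T N
  swap
  -- Without admissible periods the displacement space is zero and there is nothing to minimize.
  · have hbot := ObjStruct.Uper_eq_bot (E := ObjStruct.Vec (Fin d₁ ⊕ Fin d₂)) hne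
    refine Filter.Eventually.of_forall fun u => ?_
    have hu : u = 0 := Subtype.ext ((Submodule.mem_bot ℝ).1 (hbot ▸ u.2))
    rw [hu]
  obtain ⟨RV', hfin, hRV'⟩ := hV_range
  have hRV : ObjStruct.IsInteractionRange V (hfin.toFinset : Set {g : G // g ≠ 1}) := by
    rwa [hfin.coe_toFinset]
  obtain hd | hd | hd := hd
  · exact ObjStruct.isLocalMin_of_le_one (by omega) hper hne hV_inv hV_smooth hRV heV hR hstable
  · exact ObjStruct.isLocalMin_of_le_one hd.le hper hne hV_inv hV_smooth hRV heV hR hstable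
  · obtain rfl : d₂ = 0 := by
      have : d₁ = d₁ + d₂ := hd
      omega
    obtain ⟨N, hN⟩ := hne
    have hbot := hT.powGroup_eq_bot hN
    -- The trivial subgroup has finite index, so the group is finite.
    have hfi := hper.finiteIndex N hN
    rw [hbot] at hfi
    have : Finite G := Finite.of_equiv _ (QuotientGroup.quotientBot (G := G)).toEquiv
    have := Fintype.ofFinite G
    exact ObjStruct.isLocalMin_of_finite hper hN hbot hV_inv hV_smooth hRV heV hR hstable
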